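/- Let $n\ge 1$, $1<p,q<\infty$, $\mathbf A>0$ and $0<\delta<1$. There is a constant $C$ depending only on $n,p,q,\mathbf A,\delta$ such that the following holds. Functions are real- or complex-valued, dyadic cubes are the half-open cubes $2^{-k}(m+[0,1)^n)$ with $k\in\mathbb Z$, $m\in\mathbb Z^n$, $\mathrm{ch}(Q)$ is the set of the $2^n$ dyadic children of a dyadic cube $Q$, and $\langle f\rangle_Q=|Q|^{-1}\int_Q f\,dx$. Let $S_0\subset\mathbb R^n$ be a dyadic cube and let $b\in L^p(\mathbb R^n)$ be supported on $S_0$ with $\int b\,dx=|S_0|$ and $\|b\|_p\le \mathbf A|S_0|^{1/p}$. Let $\mathcal T'$ be the family of maximal dyadic cubes $T\subset S_0$ which satisfy $$\Bigl|\int_T b\,dx\Bigr|\le\delta|T|\qquad\text{or}\qquad \int_T|b|^p\,dx\ge\delta^{-1}\mathbf A^p|T| .$$ Let $\mathcal T$ be any family of pairwise disjoint dyadic cubes contained in $S_0$ such that every $T'\in\mathcal T'$ is contained in some $T\in\mathcal T$, and let $\mathcal Q$ be the family of all dyadic cubes contained in $S_0$ but not contained in any $T\in\mathcal T$. For $Q\in\mathcal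 Q$ define the half-twisted martingale difference $$D_Qf=\sum_{Q'\in\mathrm{ch}(Q)\setminus\mathcal T}\Bigl[\frac{\langle f\rangle_{Q'}}{\langle b\rangle_{Q'}}-\frac{\langle f\rangle_Q}{\langle b\rangle_Q}\Bigr]\mathbf 1_{Q'} .$$ Then for all constants $\varepsilon_Q$ with $|\varepsilon_Q|\le 1$, $Q\in\mathcal Q$, and all $f\in L^q(\mathbb R^n)$, the series $\sum_{Q\in\mathcal Q}\varepsilon_QD_Qf$ converges unconditionally in $L^q(\mathbb R^n)$ and $$\Bigl\|\sum_{Q\in\mathcal Q}\varepsilon_Q D_Qf\Bigr\|_q\le C\,\|f\|_q ,$$ where the norms are taken with respect to Lebesgue measure. -/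

import Mathlib

open MeasureTheory Filter Topology

/-- A dyadic cube of `ℝⁿ`, given by its generation `k ∈ ℤ` (side length `2⁻ᵏ`) and its position
`m ∈ ℤⁿ`. For `n ≥ 1` the point set of a cube determines its generation and its position. -/
@[ext]
structure DyadicCube (n : ℕ) where
  generation : ℤ
  position : Fin n → ℤ

namespace DyadicCube

variable {n : ℕ}

/-- The half-open cube `2⁻ᵏ (m + [0,1)ⁿ)`. -/
def toSet (Q : DyadicCube n) : Set (Fin n → ℝ) :=
  {x | ∀ i, x i ∈ Set.Ico ((Q.position i : ℝ) * (2 : ℝ) ^ (-Q.generation))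
    (((Q.position i : ℝ) + 1) * (2 : ℝ) ^ (-Q.generation))}

/-- The `2ⁿ` dyadic children of a cube, indexed by `e ∈ {0,1}ⁿ`. -/
def child (Q : DyadicCube n) (e : Fin n → Fin 2) : DyadicCube n where
  generation := Q.generation + 1
  position := fun i => 2 * Q.position i + ((e i : ℕ) : ℤ)

end DyadicCube

section TwistedMartingale

variable {n : ℕ} {𝕜 : Type*} [RCLike 𝕜]

/-- The average `⟨f⟩_Q = |Q|⁻¹ ∫_Q f dx`. -/
noncomputable def cubeAverage (f : (Fin n → ℝ) → 𝕜) (Q : DyadicCube n) : 𝕜 :=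
  ⨍ x in Q.toSet, f x

/-- The stopping condition on a cube `T`:
`|∫_T b dx| ≤ δ |T|` or `∫_T |b|^p dx ≥ δ⁻¹ A^p |T|`. -/
def IsStoppingCube (b : (Fin n → ℝ) → 𝕜) (p A δ : ℝ) (T : DyadicCube n) : Prop :=
  ‖∫ x in T.toSet, b x‖ ≤ δ * volume.real T.toSet ∨
    δ⁻¹ * A ^ p * volume.real T.toSet ≤ ∫ x in T.toSet, ‖b x‖ ^ p

/-- The maximal (with respect to inclusion) dyadic cubes contained in `S₀` that satisfy the
stopping condition. -/
def maximalStoppingCubes (S₀ : DyadicCube n) (b : (Fin n → ℝ) → 𝕜) (p A δ : ℝ) :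
    Set (DyadicCube n) :=
  {T | T.toSet ⊆ S₀.toSet ∧ IsStoppingCube b p A δ T ∧
    ∀ R : DyadicCube n, R.toSet ⊆ S₀.toSet → IsStoppingCube b p A δ R →
      T.toSet ⊆ R.toSet → R = T}

/-- An admissible family of terminal cubes: dyadic cubes in `S₀`, pairwise disjoint, such that
every maximal stopping cube is contained in one of them. -/
structure IsTerminalFamily (S₀ : DyadicCube n) (b : (Fin n → ℝ) → 𝕜) (p A δ : ℝ)
    (𝒯 : Set (DyadicCube n)) : Prop where
  subset : ∀ T ∈ 𝒯, T.toSet ⊆ S₀.toSet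
  disjoint : 𝒯.PairwiseDisjoint DyadicCube.toSet
  cover : ∀ T' ∈ maximalStoppingCubes S₀ b p A δ, ∃ T ∈ 𝒯, T'.toSet ⊆ T.toSet

/-- The collection `𝒬` of all dyadic cubes contained in `S₀` but not contained in any `T ∈ 𝒯`. -/
def nonterminalCubes (S₀ : DyadicCube n) (𝒯 : Set (DyadicCube n)) : Set (DyadicCube n) :=
  {Q | Q.toSet ⊆ S₀.toSet ∧ ∀ T ∈ 𝒯, ¬ Q.toSet ⊆ T.toSet}

open Classical in
/-- The half-twisted martingale difference
`D_Q f = ∑_{Q' ∈ ch(Q) \ 𝒯} (⟨f⟩_{Q'} / ⟨b⟩_{Q'} - ⟨f⟩_Q / ⟨b⟩_Q) 1_{Q'}`. -/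
noncomputable def halfTwistedDifference (b : (Fin n → ℝ) → 𝕜) (𝒯 : Set (DyadicCube n))
    (Q : DyadicCube n) (f : (Fin n → ℝ) → 𝕜) (x : Fin n → ℝ) : 𝕜 :=
  ∑ e ∈ Finset.univ.filter (fun e : Fin n → Fin 2 => Q.child e ∉ 𝒯),
    (Q.child e).toSet.indicator
      (fun _ => cubeAverage f (Q.child e) / cubeAverage b (Q.child e)
        - cubeAverage f Q / cubeAverage b Q) x

end TwistedMartingale

/-!
The averages of a function over the dyadic subcubes of `S₀` form a martingale on the tree of words
in `{0,1}ⁿ`, and the inequality is a statement about martingales on that tree.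

*Reduction to a bounded `b`.* A cube of `𝒬` is not a stopping cube, so there the averages of `b`
are bounded below by `δ` and, by Jensen's inequality, bounded above. The averages over the children
of cubes of `𝒬` are bounded above as well. Hence the martingale of `b`, frozen one step after
leaving `𝒬`, is bounded (`norm_stoppedProcessOn_le`), and the exponent `p` plays no further role.

*Bilinear estimate.* By duality the sums `∑_Q |∫ D_Q f · g|` have to be bounded for `f ∈ L^q` and
`g ∈ L^s`, with `s` conjugate to `q`. Expanding `f' / b' - f / b` to first order in the increments
`Δf`, `Δb` shows that one summand is at most a constant times the mean over the children of
`|Δf| |Δg| + (F |Δg| + G |Δf|) |Δb| + F G |Δb|²`, with `F`, `G` the averages of `|f|`, `|g|`,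
plus `F G` on the children outside `𝒬` (`norm_sum_halfTwisted_le`). The resulting form is symmetric
in `f` and `g`, so `s ≤ 2` may be assumed. With `M`, `m` the running maxima of `F`, `G`,
the products are split by the weight `m ^ (2 - s)` and its inverse. All sums that arise telescope:
squared increments of a martingale are summable against a weight that increases along the paths
(`hasDrift_mul_norm_sq`), those of `g` also against the decreasing weight `m ^ (s - 2)`
(`hasDrift_runningMax_rpow`), and a path leaves `𝒬` only once (`hasDrift_exit`). What remains are
the means of `M ^ q` and `m ^ s`, which Doob's inequality controls
(`treeMean_runningMax_rpow_le`). This gives uniform bounds for all finite sums and all exponents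
(`exists_eLpNorm_sum_halfTwistedDifference_le`).

*Unconditional convergence.* For `q ≥ 2`, Clarkson's inequality lets one choose signs so that
the `q`-th powers of the norms of disjoint blocks add up, so bounded signed sums have small tails
(`exists_tail_le_of_two_le`). For `q < 2`, functions are approximated by simple ones, for which the
tails are small in `L²`.
-/

/-! ### Martingales on the tree of words -/

section Tree

section Paths

variable {ι : Type*}

/-- The running maximum of `G` along the path from the root to a node. -/
def runningMax (G : List ι → ℝ) : List ι → ℝ
  | [] => G []
  | e :: l => max (runningMax G l) (G (e :: l))

open Classical in
/-- The process `b` frozen one step after its path leaves the set `𝒬`. -/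
noncomputable def stoppedProcessOn {R : Type*} (𝒬 : Set (List ι)) (b : List ι → R) :
    List ι → R
  | [] => b []
  | e :: l => if l ∈ 𝒬 then b (e :: l) else stoppedProcessOn 𝒬 b l

lemma le_runningMax (G : List ι → ℝ) (l : List ι) : G l ≤ runningMax G l := by
  cases l with
  | nil => exact le_rfl
  | cons e l => exact le_max_right _ _

lemma runningMax_le_cons (G : List ι → ℝ) (e : ι) (l : List ι) :
    runningMax G l ≤ runningMax G (e :: l) := le_max_left _ _

end Paths

variable {ι : Type*} [Fintype ι]

/-- The mean of `Φ` over the children `e :: l` of a node `l` of the tree of words in `ι`. -/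
noncomputable def branchMean (Φ : List ι → ℝ) (l : List ι) : ℝ :=
  (∑ e, Φ (e :: l)) / Fintype.card ι

/-- The mean of `Φ` over all words of length `k`. -/
noncomputable def treeMean : ℕ → (List ι → ℝ) → ℝ
  | 0, Φ => Φ []
  | k + 1, Φ => treeMean k (branchMean Φ)

/-- A martingale on the tree of words: the value at a node is the mean of the values at its
children. -/
def IsTreeMartingale {R : Type*} [Semiring R] (φ : List ι → R) : Prop :=
  ∀ l, ∑ e, φ (e :: l) = Fintype.card ι * φ l

/-- `P` has drift at least `D`: in one step of the tree, the mean of `P` grows by at least `D`. -/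
def HasDrift (P D : List ι → ℝ) : Prop :=
  ∀ l, P l + D l ≤ branchMean P l

lemma branchMean_mono {Φ Ψ : List ι → ℝ} (h : ∀ l, Φ l ≤ Ψ l) (l : List ι) :
    branchMean Φ l ≤ branchMean Ψ l := by
  unfold branchMean
  gcongr
  exact h _

lemma branchMean_add (Φ Ψ : List ι → ℝ) :
    branchMean (fun l => Φ l + Ψ l) = fun l => branchMean Φ l + branchMean Ψ l := by
  funext l
  simp only [branchMean, Finset.sum_add_distrib, add_div]

lemma branchMean_const_mul (c : ℝ) (Φ : List ι → ℝ) :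
    branchMean (fun l => c * Φ l) = fun l => c * branchMean Φ l := by
  funext l
  simp only [branchMean, ← Finset.mul_sum, mul_div_assoc]

lemma treeMean_mono (k : ℕ) : ∀ {Φ Ψ : List ι → ℝ}, (∀ l, Φ l ≤ Ψ l) →
    treeMean k Φ ≤ treeMean k Ψ := by
  induction k with
  | zero => intro Φ Ψ h; exact h []
  | succ k ih => intro Φ Ψ h; exact ih (branchMean_mono h)

lemma treeMean_add (k : ℕ) : ∀ Φ Ψ : List ι → ℝ,
    treeMean k (fun l => Φ l + Ψ l) = treeMean k Φ + treeMean k Ψ := by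
  induction k with
  | zero => intro Φ Ψ; rfl
  | succ k ih => intro Φ Ψ; simp only [treeMean, branchMean_add, ih]

lemma treeMean_const_mul (k : ℕ) (c : ℝ) : ∀ Φ : List ι → ℝ,
    treeMean k (fun l => c * Φ l) = c * treeMean k Φ := by
  induction k with
  | zero => intro Φ; rfl
  | succ k ih => intro Φ; simp only [treeMean, branchMean_const_mul, ih]

lemma treeMean_nonneg (k : ℕ) {Φ : List ι → ℝ} (h : ∀ l, 0 ≤ Φ l) : 0 ≤ treeMean k Φ := by
  have := treeMean_mono k (Φ := fun l => 0 * Φ l) (Ψ := Φ) (by simpa using h)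
  rwa [treeMean_const_mul, zero_mul] at this

lemma card_pos_real [Nonempty ι] : (0 : ℝ) < Fintype.card ι := by
  exact_mod_cast Fintype.card_pos

lemma one_le_card_real [Nonempty ι] : (1 : ℝ) ≤ Fintype.card ι := by
  exact_mod_cast Fintype.card_pos (α := ι)

lemma treeMean_martingale [Nonempty ι] {F : List ι → ℝ} (hF : IsTreeMartingale F) (k : ℕ) :
    treeMean k F = F [] := by
  have h : branchMean F = F := by
    funext l
    rw [branchMean, hF l, mul_div_cancel_left₀ _ card_pos_real.ne']
  induction k with
  | zero => rfl
  | succ k ih => rw [treeMean, h, ih]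

/-- The drifts at all levels are controlled by the final mean. -/
lemma HasDrift.sum_le {P D : List ι → ℝ} (h : HasDrift P D) (K : ℕ) :
    P [] + ∑ k ∈ Finset.range K, treeMean k D ≤ treeMean K P := by
  induction K with
  | zero => simp [treeMean]
  | succ K ih =>
    rw [Finset.sum_range_succ, ← add_assoc]
    calc _ ≤ treeMean K P + treeMean K D := by gcongr
      _ = treeMean K (fun l => P l + D l) := (treeMean_add _ _ _).symm
      _ ≤ _ := treeMean_mono K h

lemma HasDrift.add {P D P' D' : List ι → ℝ} (h : HasDrift P D) (h' : HasDrift P' D') :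
    HasDrift (fun l => P l + P' l) (fun l => D l + D' l) := by
  intro l
  rw [branchMean_add]
  linarith [h l, h' l]

lemma HasDrift.const_mul {P D : List ι → ℝ} (h : HasDrift P D) {c : ℝ} (hc : 0 ≤ c) :
    HasDrift (fun l => c * P l) (fun l => c * D l) := by
  intro l
  rw [branchMean_const_mul, ← mul_add]
  exact mul_le_mul_of_nonneg_left (h l) hc

lemma hasDrift_iff [Nonempty ι] {P D : List ι → ℝ} :
    HasDrift P D ↔ ∀ l, Fintype.card ι * (P l + D l) ≤ ∑ e, P (e :: l) := by
  refine forall_congr' fun l => ?_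
  rw [branchMean, le_div_iff₀ card_pos_real, mul_comm]

/-- A sum over some words of length `k` is at most the sum over all of them. -/
lemma sum_le_treeMean [Nonempty ι] (k : ℕ) :
    ∀ {Φ : List ι → ℝ}, (∀ l, 0 ≤ Φ l) → ∀ L : Finset (List ι),
    (∀ l ∈ L, l.length = k) → ∑ l ∈ L, Φ l ≤ (Fintype.card ι : ℝ) ^ k * treeMean k Φ := by
  classical
  induction k with
  | zero =>
    intro Φ hΦ L hL
    have : L ⊆ {[]} := fun l hl => by simpa using List.length_eq_zero_iff.1 (hL l hl)
    simpa [treeMean] using Finset.sum_le_sum_of_subset_of_nonneg this (fun l _ _ => hΦ l)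
  | succ k ih =>
    intro Φ hΦ L hL
    have hsub : L ⊆ ((L.image List.tail) ×ˢ (Finset.univ : Finset ι)).image
        (fun x => x.2 :: x.1) := by
      intro l hl
      obtain ⟨e, l', rfl⟩ := List.exists_of_length_succ l (hL l hl)
      simp only [Finset.mem_image, Finset.mem_product]
      exact ⟨(l', e), ⟨⟨_, hl, rfl⟩, Finset.mem_univ _⟩, rfl⟩
    have hinj : Function.Injective (fun x : List ι × ι => x.2 :: x.1) := by
      rintro ⟨a, b⟩ ⟨c, d⟩ h
      simp only [List.cons.injEq] at h
      simp [h.1, h.2]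
    have hb : ∀ l, 0 ≤ branchMean Φ l := fun l =>
      div_nonneg (Finset.sum_nonneg fun e _ => hΦ _) card_pos_real.le
    calc ∑ l ∈ L, Φ l ≤ ∑ l ∈ L.image List.tail, ∑ e, Φ (e :: l) := by
          rw [← Finset.sum_product', ← Finset.sum_image (f := Φ) (fun x _ y _ h => hinj h)]
          exact Finset.sum_le_sum_of_subset_of_nonneg hsub (fun l _ _ => hΦ l)
      _ = Fintype.card ι * ∑ l ∈ L.image List.tail, branchMean Φ l := by
          rw [Finset.mul_sum]
          refine Finset.sum_congr rfl fun l _ => ?_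
          rw [branchMean, mul_div_cancel₀ _ card_pos_real.ne']
      _ ≤ Fintype.card ι * ((Fintype.card ι : ℝ) ^ k * treeMean k (branchMean Φ)) := by
          gcongr
          refine ih hb _ ?_
          intro l hl
          obtain ⟨l', hl', rfl⟩ := Finset.mem_image.1 hl
          simp [hL l' hl']
      _ = _ := by rw [treeMean]; ring

section Processes

variable {𝕜 : Type*} [RCLike 𝕜]

lemma IsTreeMartingale.sum_norm_sub_sq {φ : List ι → 𝕜} (hφ : IsTreeMartingale φ) (l : List ι) :
    ∑ e, ‖φ (e :: l) - φ l‖ ^ 2 = ∑ e, ‖φ (e :: l)‖ ^ 2 - Fintype.card ι * ‖φ l‖ ^ 2 := by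
  have h : ∑ e, RCLike.re (inner 𝕜 (φ (e :: l)) (φ l)) = Fintype.card ι * ‖φ l‖ ^ 2 := by
    rw [← map_sum, ← sum_inner, hφ l, ← nsmul_eq_mul, ← Nat.cast_smul_eq_nsmul 𝕜, inner_smul_left,
      inner_self_eq_norm_sq_to_K]
    rw [map_natCast, ← RCLike.ofReal_natCast, ← RCLike.ofReal_pow, ← RCLike.ofReal_mul,
      RCLike.ofReal_re]
  simp only [norm_sub_sq (𝕜 := 𝕜), Finset.sum_add_distrib, Finset.sum_sub_distrib,
    ← Finset.mul_sum, h, Finset.sum_const, Finset.card_univ, nsmul_eq_mul]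
  ring

/-- Summation by parts: the square of a martingale, weighted by a weight that increases along
the paths, has the weighted squared increments as its drift. -/
lemma hasDrift_mul_norm_sq [Nonempty ι] {φ : List ι → 𝕜} (hφ : IsTreeMartingale φ) {w : List ι → ℝ}
    (hw : ∀ e l, w l ≤ w (e :: l)) :
    HasDrift (fun l => w l * ‖φ l‖ ^ 2)
      (fun l => w l * ((∑ e, ‖φ (e :: l) - φ l‖ ^ 2) / Fintype.card ι)) := by
  rw [hasDrift_iff]
  intro l
  have hc := (card_pos_real (ι := ι)).ne'
  calc _ = ∑ e, w l * ‖φ (e :: l)‖ ^ 2 := by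
        rw [hφ.sum_norm_sub_sq, ← Finset.mul_sum]; field_simp; ring
    _ ≤ _ := Finset.sum_le_sum fun e _ => by gcongr; exact hw e l

lemma IsTreeMartingale.le_card_mul {F : List ι → ℝ} (hF : IsTreeMartingale F)
    (h0 : ∀ l, 0 ≤ F l) (e : ι) (l : List ι) : F (e :: l) ≤ Fintype.card ι * F l := by
  rw [← hF l]
  exact Finset.single_le_sum (f := fun e => F (e :: l)) (fun e _ => h0 _) (Finset.mem_univ e)

lemma runningMax_cons_le [Nonempty ι] {G : List ι → ℝ} (hG : IsTreeMartingale G) (h0 : ∀ l, 0 ≤ G l)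
    (e : ι) (l : List ι) : runningMax G (e :: l) ≤ Fintype.card ι * runningMax G l := by
  have h1 := one_le_card_real (ι := ι)
  have h2 := le_runningMax G l
  refine max_le ?_ ((hG.le_card_mul h0 e l).trans (by gcongr))
  exact le_mul_of_one_le_left ((h0 l).trans h2) h1


lemma rpow_sub_two_sub_mul_sq_le {s m m' N : ℝ} (hs : 1 ≤ s) (hm : 0 < m)
    (h : m ≤ m') (h' : m' ≤ N * m) :
    (m ^ (s - 2) - m' ^ (s - 2)) * m' ^ 2 ≤ N ^ s * (m' ^ s - m ^ s) := by
  obtain ⟨t, rfl⟩ : ∃ t, m' = t * m := ⟨m' / m, by field_simp⟩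
  have ht : 1 ≤ t := by
    by_contra! hlt
    nlinarith
  have ht0 : 0 < t := by linarith
  have htN : t ≤ N := le_of_mul_le_mul_right h' hm
  have e1 : m ^ (s - 2) * m ^ 2 = m ^ s := by
    rw [← Real.rpow_natCast, ← Real.rpow_add hm]; norm_num
  have e2 : t ^ (s - 2) * t ^ 2 = t ^ s := by
    rw [← Real.rpow_natCast, ← Real.rpow_add ht0]; norm_num
  have e3 : t ^ 2 = t ^ s * t ^ (2 - s) := by
    rw [← Real.rpow_add ht0, ← Real.rpow_natCast]; norm_num
  have h1 : t ^ (2 - s) ≤ t := by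
    simpa using Real.rpow_le_rpow_of_exponent_le ht (show 2 - s ≤ 1 by linarith)
  have h2 : t ≤ t ^ s := by
    simpa using Real.rpow_le_rpow_of_exponent_le ht hs
  have h3 : t ^ s ≤ N ^ s := Real.rpow_le_rpow ht0.le htN (by linarith)
  rw [Real.mul_rpow ht0.le hm.le, Real.mul_rpow ht0.le hm.le]
  have hms : 0 < m ^ s := Real.rpow_pos_of_pos hm s
  have hts : 0 < t ^ s := Real.rpow_pos_of_pos ht0 s
  have key : t ^ 2 - t ^ s ≤ N ^ s * (t ^ s - 1) := by
    calc t ^ 2 - t ^ s = t ^ s * (t ^ (2 - s) - 1) := by rw [e3]; ring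
      _ ≤ t ^ s * (t ^ s - 1) := by gcongr; linarith
      _ ≤ _ := by gcongr; linarith
  calc _ = m ^ (s - 2) * m ^ 2 * (t ^ 2 - t ^ (s - 2) * t ^ 2) := by ring
    _ = m ^ s * (t ^ 2 - t ^ s) := by rw [e1, e2]
    _ ≤ m ^ s * (N ^ s * (t ^ s - 1)) := by gcongr
    _ = _ := by ring

/-- For `1 < s ≤ 2` the weight `m ^ (s - 2)` decreases along the paths. What the summation by
parts loses by this is recovered from the growth of `m ^ s`, since `m` grows by a bounded factor
in each step. -/
lemma hasDrift_runningMax_rpow [Nonempty ι] {g : List ι → 𝕜} {G : List ι → ℝ}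
    (hg : IsTreeMartingale g) (hG : IsTreeMartingale G) (hgG : ∀ l, ‖g l‖ ≤ G l)
    {s : ℝ} (hs : 1 < s) (hs2 : s ≤ 2) :
    HasDrift (fun l => runningMax G l ^ (s - 2) * ‖g l‖ ^ 2
        + (Fintype.card ι : ℝ) ^ s * runningMax G l ^ s)
      (fun l => runningMax G l ^ (s - 2) *
        ((∑ e, ‖g (e :: l) - g l‖ ^ 2) / Fintype.card ι)) := by
  rw [hasDrift_iff]
  intro l
  have hc := (card_pos_real (ι := ι)).ne'
  have h0 : ∀ l, 0 ≤ G l := fun l => (norm_nonneg _).trans (hgG l)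
  calc _ = ∑ e, (runningMax G l ^ (s - 2) * ‖g (e :: l)‖ ^ 2
        + (Fintype.card ι : ℝ) ^ s * runningMax G l ^ s) := by
        rw [hg.sum_norm_sub_sq, Finset.sum_add_distrib, ← Finset.mul_sum]
        simp only [Finset.sum_const, Finset.card_univ, nsmul_eq_mul]
        field_simp; ring
    _ ≤ _ := Finset.sum_le_sum fun e _ => ?_
  have hm0 : 0 ≤ runningMax G l := (h0 l).trans (le_runningMax G l)
  have hm' := runningMax_le_cons G e l
  have hgm' : ‖g (e :: l)‖ ≤ runningMax G (e :: l) := (hgG _).trans (le_runningMax _ _)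
  -- For `m = 0` the power `m ^ (s - 2)` is a junk value, but `g` vanishes from there on.
  rcases hm0.eq_or_lt with hm | hm
  · have : ‖g (e :: l)‖ = 0 := by
      refine le_antisymm ?_ (norm_nonneg _)
      refine hgm'.trans ((runningMax_cons_le hG h0 e l).trans ?_)
      rw [← hm, mul_zero]
    rw [this]
    have h2 := Real.rpow_le_rpow hm0 hm' (show 0 ≤ s by linarith)
    have h3 : 0 ≤ (Fintype.card ι : ℝ) ^ s := by positivity
    nlinarith
  · have key := rpow_sub_two_sub_mul_sq_le hs.le hm hm' (runningMax_cons_le hG h0 e l)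
    have h1 : runningMax G (e :: l) ^ (s - 2) ≤ runningMax G l ^ (s - 2) :=
      Real.rpow_le_rpow_of_nonpos hm hm' (by linarith)
    have h2 : ‖g (e :: l)‖ ^ 2 ≤ runningMax G (e :: l) ^ 2 := by gcongr
    nlinarith [mul_le_mul_of_nonneg_left h2 (sub_nonneg.2 h1)]

/-- The weak form of Young's inequality behind the homogeneity `2 / q + (2 - s) / s = 1`. -/
lemma sq_mul_rpow_two_sub_le {q s x y : ℝ} (h : q.HolderConjugate s) (hs2 : s ≤ 2)
    (hx : 0 ≤ x) (hy : 0 ≤ y) : x ^ 2 * y ^ (2 - s) ≤ x ^ q + y ^ s := by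
  have hq0 : 0 < q := h.pos
  have hs0 : 0 < s := h.symm.pos
  have hqs : q + s = q * s := by have := h.mul_eq_add; linarith
  rcases hx.eq_or_lt with rfl | hx'
  · rw [zero_pow two_ne_zero, zero_mul]; positivity
  rcases hy.eq_or_lt with rfl | hy'
  · rcases hs2.eq_or_lt with rfl | hlt
    · have : q = 2 := by linarith
      subst this
      simp
    · rw [Real.zero_rpow (by linarith), mul_zero]; positivity
  rcases le_total (y ^ s) (x ^ q) with hc | hc
  · have h1 : y ^ (2 - s) ≤ x ^ (q - 2) := by
      calc y ^ (2 - s) = (y ^ s) ^ ((2 - s) / s) := by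
            rw [← Real.rpow_mul hy]; congr 1; field_simp
        _ ≤ (x ^ q) ^ ((2 - s) / s) :=
            Real.rpow_le_rpow (by positivity) hc (div_nonneg (by linarith) hs0.le)
        _ = _ := by rw [← Real.rpow_mul hx]; congr 1; field_simp; linarith
    calc x ^ 2 * y ^ (2 - s) ≤ x ^ 2 * x ^ (q - 2) := by gcongr
      _ = x ^ q := by rw [← Real.rpow_natCast, ← Real.rpow_add hx']; norm_num
      _ ≤ _ := le_add_of_nonneg_right (by positivity)
  · have h1 : x ^ 2 ≤ y ^ (2 * s - 2) := by
      calc x ^ 2 = (x ^ q) ^ (2 / q) := by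
            rw [← Real.rpow_mul hx, ← Real.rpow_natCast]; congr 1; field_simp; norm_num
        _ ≤ (y ^ s) ^ (2 / q) := Real.rpow_le_rpow (by positivity) hc (by positivity)
        _ = _ := by rw [← Real.rpow_mul hy]; congr 1; field_simp; linarith
    calc x ^ 2 * y ^ (2 - s) ≤ y ^ (2 * s - 2) * y ^ (2 - s) := by gcongr
      _ = y ^ s := by rw [← Real.rpow_add hy']; ring_nf
      _ ≤ _ := le_add_of_nonneg_left (by positivity)

lemma mul_le_rpow_add_rpow {q s x y : ℝ} (h : q.HolderConjugate s)
    (hx : 0 ≤ x) (hy : 0 ≤ y) : x * y ≤ x ^ q + y ^ s := by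
  refine (Real.young_inequality_of_nonneg hx hy h).trans ?_
  gcongr
  · exact div_le_self (by positivity) h.lt.le
  · exact div_le_self (by positivity) h.symm.lt.le

/-- One step of Doob's inequality: `s m ^ (s - 1) G - (s - 1) m ^ s` is a submartingale, by the
convexity of `x ^ s` when the maximum increases. -/
lemma hasDrift_doob [Nonempty ι] {G : List ι → ℝ} (hG : IsTreeMartingale G) (h0 : ∀ l, 0 ≤ G l)
    {s : ℝ} (hs : 1 < s) :
    HasDrift (fun l => s * (runningMax G l ^ (s - 1) * G l) - (s - 1) * runningMax G l ^ s)
      (fun _ => 0) := by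
  rw [hasDrift_iff]
  intro l
  calc _ = ∑ e, (s * (runningMax G l ^ (s - 1) * G (e :: l))
        - (s - 1) * runningMax G l ^ s) := by
        rw [Finset.sum_sub_distrib, ← Finset.mul_sum, ← Finset.mul_sum, hG l]
        simp only [Finset.sum_const, Finset.card_univ, nsmul_eq_mul]
        ring
    _ ≤ _ := Finset.sum_le_sum fun e _ => ?_
  have hm0 : 0 ≤ runningMax G l := (h0 l).trans (le_runningMax G l)
  rcases le_total (G (e :: l)) (runningMax G l) with h | h
  · rw [show runningMax G (e :: l) = runningMax G l from max_eq_left h]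
  · rw [show runningMax G (e :: l) = G (e :: l) from max_eq_right h]
    have e1 : G (e :: l) ^ (s - 1) * G (e :: l) = G (e :: l) ^ s := by
      rw [← Real.rpow_add_one' (h0 _) (by linarith)]; ring_nf
    rw [e1]
    have hconj : s.HolderConjugate (s / (s - 1)) := Real.HolderConjugate.conjExponent hs
    have hy := Real.young_inequality_of_nonneg (h0 (e :: l))
      (Real.rpow_nonneg hm0 (s - 1)) hconj
    rw [← Real.rpow_mul hm0, mul_div_cancel₀ _ (by linarith : s - 1 ≠ 0)] at hy
    have hs0 : 0 < s := by linarith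
    have hs1 : 0 < s - 1 := by linarith
    have hy2 := mul_le_mul_of_nonneg_left hy hs0.le
    rw [mul_add, mul_div_cancel₀ _ hs0.ne', show s * (runningMax G l ^ s / (s / (s - 1)))
      = (s - 1) * runningMax G l ^ s by field_simp] at hy2
    linarith

/-- **Doob's maximal inequality** on the tree. -/
lemma treeMean_runningMax_rpow_le [Nonempty ι] {s : ℝ} (hs : 1 < s) :
    ∃ C : ℝ, 0 < C ∧ ∀ G : List ι → ℝ, IsTreeMartingale G → (∀ l, 0 ≤ G l) → ∀ K,
      treeMean K (fun l => runningMax G l ^ s) ≤ C * treeMean K (fun l => G l ^ s) := by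
  have hs0 : 0 < s := by linarith
  have hs1 : 0 < s - 1 := by linarith
  obtain ⟨θ, hθ⟩ : ∃ θ : ℝ, θ = (s - 1) / (2 * s) := ⟨_, rfl⟩
  have hθ0 : 0 < θ := by rw [hθ]; positivity
  refine ⟨2 / (s - 1) * (s * θ ^ (1 - s)), by positivity, fun G hG h0 K => ?_⟩
  have hm0 : ∀ l, 0 ≤ runningMax G l := fun l => (h0 l).trans (le_runningMax G l)
  have hstart : 0 ≤ s * (runningMax G [] ^ (s - 1) * G []) - (s - 1) * runningMax G [] ^ s := by
    rw [show runningMax G [] = G [] from rfl, ← Real.rpow_add_one' (h0 _) (by linarith)]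
    have := Real.rpow_nonneg (h0 []) s
    ring_nf
    linarith
  have h1 := (hasDrift_doob hG h0 hs).sum_le K
  have hz : ∀ k, treeMean k (fun _ : List ι => (0 : ℝ)) = 0 := fun k => by
    simpa using treeMean_const_mul k 0 (fun _ : List ι => (0 : ℝ))
  -- Where `G ≤ θ m` the mixed term is absorbed, elsewhere it is comparable with `G ^ s`.
  have h2 : treeMean K (fun l => s * (runningMax G l ^ (s - 1) * G l)
        - (s - 1) * runningMax G l ^ s)
      ≤ treeMean K (fun l => s * θ ^ (1 - s) * G l ^ s + -((s - 1) / 2) * runningMax G l ^ s) := by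
    refine treeMean_mono K fun l => ?_
    suffices s * (runningMax G l ^ (s - 1) * G l)
        ≤ (s - 1) / 2 * runningMax G l ^ s + s * θ ^ (1 - s) * G l ^ s by linarith
    have hGs := Real.rpow_nonneg (h0 l) s
    have hms := Real.rpow_nonneg (hm0 l) s
    rcases le_total (G l) (θ * runningMax G l) with h | h
    · calc s * (runningMax G l ^ (s - 1) * G l)
          ≤ s * (runningMax G l ^ (s - 1) * (θ * runningMax G l)) := by
            gcongr; exact Real.rpow_nonneg (hm0 l) _
        _ = s * θ * (runningMax G l ^ (s - 1) * runningMax G l) := by ring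
        _ = (s - 1) / 2 * runningMax G l ^ s := by
            rw [← Real.rpow_add_one' (hm0 l) (by linarith), hθ]
            field_simp
            ring_nf
        _ ≤ _ := le_add_of_nonneg_right (by positivity)
    · have h3 : runningMax G l ^ (s - 1) ≤ θ ^ (1 - s) * G l ^ (s - 1) := by
        have : runningMax G l ≤ θ⁻¹ * G l := by
          rw [inv_mul_eq_div, le_div_iff₀ hθ0]; linarith
        refine (Real.rpow_le_rpow (hm0 l) this hs1.le).trans_eq ?_
        rw [Real.mul_rpow (by positivity) (h0 l), Real.inv_rpow hθ0.le, ← Real.rpow_neg hθ0.le]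
        ring_nf
      calc s * (runningMax G l ^ (s - 1) * G l)
          ≤ s * (θ ^ (1 - s) * G l ^ (s - 1) * G l) := by gcongr; exact h0 l
        _ = s * θ ^ (1 - s) * (G l ^ (s - 1) * G l) := by ring
        _ = s * θ ^ (1 - s) * G l ^ s := by
            rw [← Real.rpow_add_one' (h0 l) (by linarith)]; ring_nf
        _ ≤ _ := le_add_of_nonneg_left (by positivity)
  rw [treeMean_add, treeMean_const_mul, treeMean_const_mul] at h2
  simp only [hz, Finset.sum_const_zero, add_zero] at h1
  have h4 : (s - 1) / 2 * treeMean K (fun l => runningMax G l ^ s)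
      ≤ s * θ ^ (1 - s) * treeMean K (fun l => G l ^ s) := by linarith
  calc _ = 2 / (s - 1) * ((s - 1) / 2 * treeMean K (fun l => runningMax G l ^ s)) := by
        field_simp
    _ ≤ 2 / (s - 1) * (s * θ ^ (1 - s) * treeMean K (fun l => G l ^ s)) := by gcongr
    _ = _ := by ring

end Processes
end Tree

/-! ### The bilinear estimate on the tree -/

section TreeEstimate

variable {ι : Type*} [Fintype ι] {𝕜 : Type*} [RCLike 𝕜]

section Stopping

variable {ι : Type*} {𝒬 : Set (List ι)}

lemma stoppedProcessOn_cons_of_mem {R : Type*} {b : List ι → R} {l : List ι} (hl : l ∈ 𝒬)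
    (e : ι) : stoppedProcessOn 𝒬 b (e :: l) = b (e :: l) := by
  simp [stoppedProcessOn, hl]

lemma stoppedProcessOn_of_mem {R : Type*} (h𝒬 : ∀ e l, e :: l ∈ 𝒬 → l ∈ 𝒬) {b : List ι → R}
    {l : List ι} (hl : l ∈ 𝒬) : stoppedProcessOn 𝒬 b l = b l := by
  cases l with
  | nil => rfl
  | cons e l => exact stoppedProcessOn_cons_of_mem (h𝒬 e l hl) e

lemma norm_stoppedProcessOn_le {b : List ι → 𝕜} {B : ℝ} (h0 : ‖b []‖ ≤ B)
    (hB : ∀ l ∈ 𝒬, ∀ e, ‖b (e :: l)‖ ≤ B) (l : List ι) : ‖stoppedProcessOn 𝒬 b l‖ ≤ B := by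
  induction l with
  | nil => exact h0
  | cons e l ih =>
    rw [stoppedProcessOn]
    split_ifs with h
    · exact hB l h e
    · exact ih

open Classical in
/-- Indicator of the event that a path leaves `𝒬` in the step from `l` to `e :: l`. -/
noncomputable def exitIndicator (𝒬 : Set (List ι)) (l : List ι) (e : ι) : ℝ :=
  if l ∈ 𝒬 ∧ e :: l ∉ 𝒬 then 1 else 0

lemma exitIndicator_nonneg (l : List ι) (e : ι) : 0 ≤ exitIndicator 𝒬 l e := by
  unfold exitIndicator
  split_ifs <;> norm_num

/-- Each product of increments is split by the weight `m_G ^ (2 - s)`, which increases along the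
paths, and its inverse, which is the weight of `hasDrift_runningMax_rpow`. -/
lemma interaction_le_weighted {F G a c d x : ℝ} {M m s : ℝ}
    (hF : 0 ≤ F) (hG : 0 ≤ G) (ha : 0 ≤ a) (hc : 0 ≤ c) (hd : 0 ≤ d) (hx : 0 ≤ x)
    (hFM : F ≤ M) (hGm : G ≤ m) (hm0 : m = 0 → c = 0) :
    a * c + (F * c + G * a) * d + F * G * d ^ 2 + F * G * x
      ≤ 2 * (m ^ (2 - s) * a ^ 2) + 2 * (m ^ (s - 2) * c ^ 2)
        + (m ^ (2 - s) * M ^ 2) * d ^ 2 + m ^ s * d ^ 2 + M * m * d ^ 2 + M * m * x := by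
  have hM : 0 ≤ M := hF.trans hFM
  have hm : 0 ≤ m := hG.trans hGm
  have h5 : F * G ≤ M * m := by gcongr
  have h6 : F * G * d ^ 2 ≤ M * m * d ^ 2 := by gcongr
  have h7 : F * G * x ≤ M * m * x := by gcongr
  -- For `m = 0` the power `m ^ (s - 2)` is a junk value, but `c` vanishes.
  rcases hm.eq_or_lt with h | h
  · have hc0 : c = 0 := hm0 h.symm
    have hG0 : G = 0 := le_antisymm (h ▸ hGm) hG
    subst hc0 hG0
    have : 0 ≤ 2 * (m ^ (2 - s) * a ^ 2) + 2 * (m ^ (s - 2) * 0 ^ 2)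
        + (m ^ (2 - s) * M ^ 2) * d ^ 2 + m ^ s * d ^ 2 + M * m * d ^ 2 + M * m * x := by
      positivity
    simpa using this
  · obtain ⟨y, hy⟩ : ∃ y, y = m ^ ((2 - s) / 2) := ⟨_, rfl⟩
    have hy0 : 0 < y := by rw [hy]; positivity
    have e1 : m ^ (2 - s) = y ^ 2 := by
      rw [hy, ← Real.rpow_natCast, ← Real.rpow_mul hm]; congr 1; push_cast; ring
    have e2 : m ^ (s - 2) = (y⁻¹) ^ 2 := by
      rw [inv_pow, ← e1, ← Real.rpow_neg hm]; congr 1; ring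
    have e3 : m ^ s = (y⁻¹ * m) ^ 2 := by
      rw [mul_pow, ← e2, ← Real.rpow_natCast, ← Real.rpow_add h]; congr 1; push_cast; ring
    rw [e1, e2, e3]
    have t1 : a * c ≤ (y * a) ^ 2 + (y⁻¹ * c) ^ 2 := by
      have : a * c = (y * a) * (y⁻¹ * c) := by field_simp
      rw [this]; nlinarith [sq_nonneg (y * a - y⁻¹ * c), sq_nonneg (y * a), sq_nonneg (y⁻¹ * c)]
    have t2 : F * c * d ≤ (y * M * d) ^ 2 + (y⁻¹ * c) ^ 2 := by
      have : M * c * d = (y * M * d) * (y⁻¹ * c) := by field_simp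
      have h8 : F * c * d ≤ M * c * d := by gcongr
      nlinarith [sq_nonneg (y * M * d - y⁻¹ * c), sq_nonneg (y * M * d), sq_nonneg (y⁻¹ * c)]
    have t3 : G * a * d ≤ (y * a) ^ 2 + (y⁻¹ * m * d) ^ 2 := by
      have : m * a * d = (y * a) * (y⁻¹ * m * d) := by field_simp
      have h8 : G * a * d ≤ m * a * d := by gcongr
      nlinarith [sq_nonneg (y * a - y⁻¹ * m * d), sq_nonneg (y * a), sq_nonneg (y⁻¹ * m * d)]
    linarith

end Stopping

variable {𝒬 : Set (List ι)}

lemma IsTreeMartingale.stoppedProcessOn (h𝒬 : ∀ e l, e :: l ∈ 𝒬 → l ∈ 𝒬) {b : List ι → 𝕜}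
    (hb : IsTreeMartingale b) : IsTreeMartingale (stoppedProcessOn 𝒬 b) := by
  intro l
  by_cases hl : l ∈ 𝒬
  · simp only [stoppedProcessOn_cons_of_mem hl, stoppedProcessOn_of_mem h𝒬 hl, hb l]
  · simp [_root_.stoppedProcessOn, hl]

/-- The mean over the children of all the products of increments of `f`, `g` and `β` that come up
in the pairing of a half-twisted difference with `g`. Here `F` and `G` majorize `f` and `g`. -/
noncomputable def interactionKernel (𝒬 : Set (List ι)) (f g β : List ι → 𝕜) (F G : List ι → ℝ)
    (l : List ι) : ℝ :=
  (∑ e, (‖f (e :: l) - f l‖ * ‖g (e :: l) - g l‖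
    + (F l * ‖g (e :: l) - g l‖ + G l * ‖f (e :: l) - f l‖) * ‖β (e :: l) - β l‖
    + F l * G l * ‖β (e :: l) - β l‖ ^ 2 + F l * G l * exitIndicator 𝒬 l e)) / Fintype.card ι

lemma interactionKernel_comm (𝒬 : Set (List ι)) (f g β : List ι → 𝕜) (F G : List ι → ℝ) :
    interactionKernel 𝒬 f g β F G = interactionKernel 𝒬 g f β G F := by
  funext l
  unfold interactionKernel
  congr 1
  refine Finset.sum_congr rfl fun e _ => ?_
  ring

lemma interactionKernel_nonneg {f g β : List ι → 𝕜}
    {F G : List ι → ℝ} (hF : ∀ l, 0 ≤ F l) (hG : ∀ l, 0 ≤ G l) (l : List ι) :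
    0 ≤ interactionKernel 𝒬 f g β F G l := by
  unfold interactionKernel
  refine div_nonneg (Finset.sum_nonneg fun e _ => ?_) (by positivity)
  have := hF l
  have := hG l
  have := exitIndicator_nonneg (𝒬 := 𝒬) l e
  positivity

/-- A path leaves `𝒬` at most once, so the exits are summable against an increasing weight. -/
lemma hasDrift_exit [Nonempty ι] (h𝒬 : ∀ e l, e :: l ∈ 𝒬 → l ∈ 𝒬) {w : List ι → ℝ}
    (hw : ∀ e l, w l ≤ w (e :: l)) :
    HasDrift (fun l => w l * 𝒬ᶜ.indicator 1 l)
      (fun l => w l * ((∑ e, exitIndicator 𝒬 l e) / Fintype.card ι)) := by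
  rw [hasDrift_iff]
  intro l
  have hc := (card_pos_real (ι := ι)).ne'
  calc _ = ∑ e, (w l * 𝒬ᶜ.indicator 1 l + w l * exitIndicator 𝒬 l e) := by
        rw [Finset.sum_add_distrib, ← Finset.mul_sum]
        simp only [Finset.sum_const, Finset.card_univ, nsmul_eq_mul]
        rw [← Finset.mul_sum]
        field_simp
    _ ≤ _ := Finset.sum_le_sum fun e _ => ?_
  by_cases hl : l ∈ 𝒬 <;> by_cases hel : e :: l ∈ 𝒬
  · simp [exitIndicator, hl, hel]
  · simpa [exitIndicator, hl, hel] using hw e l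
  · exact absurd (h𝒬 e l hel) hl
  · simpa [exitIndicator, hl, hel] using hw e l

/-- The bilinear estimate on the tree, for the exponent of `g` at most `2`. -/
lemma sum_treeMean_interactionKernel_le_of_le_two [Nonempty ι] {q s : ℝ}
    (hqs : q.HolderConjugate s) (hs2 : s ≤ 2) {B : ℝ} :
    ∃ C : ℝ, 0 < C ∧ ∀ 𝒬 : Set (List ι), (∀ e l, e :: l ∈ 𝒬 → l ∈ 𝒬) →
      ∀ (f g β : List ι → 𝕜) (F G : List ι → ℝ), IsTreeMartingale f → IsTreeMartingale g →
      IsTreeMartingale β → IsTreeMartingale F → IsTreeMartingale G →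
      (∀ l, ‖f l‖ ≤ F l) → (∀ l, ‖g l‖ ≤ G l) → (∀ l, ‖β l‖ ≤ B) → ∀ K,
      ∑ k ∈ Finset.range K, treeMean k (interactionKernel 𝒬 f g β F G)
        ≤ C * (treeMean K (fun l => F l ^ q) + treeMean K (fun l => G l ^ s)) := by
  obtain ⟨C₁, hC₁, hD₁⟩ := treeMean_runningMax_rpow_le (ι := ι) hqs.lt
  obtain ⟨C₂, hC₂, hD₂⟩ := treeMean_runningMax_rpow_le (ι := ι) hqs.symm.lt
  have hs : 1 < s := hqs.symm.lt
  set N : ℝ := (Fintype.card ι : ℝ) with hN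
  have hN0 : 0 < N := card_pos_real
  set c : ℝ := 2 + 2 * (1 + N ^ s) + 3 * B ^ 2 + 1 with hc
  have hc0 : 0 < c := by positivity
  refine ⟨c * (C₁ + C₂), by positivity, ?_⟩
  intro 𝒬 h𝒬 f g β F G hf hg hβ hF hG hfF hgG hβB K
  have hF0 : ∀ l, 0 ≤ F l := fun l => (norm_nonneg _).trans (hfF l)
  have hG0 : ∀ l, 0 ≤ G l := fun l => (norm_nonneg _).trans (hgG l)
  set M := runningMax F with hM
  set m := runningMax G with hm
  have hM0 : ∀ l, 0 ≤ M l := fun l => (hF0 l).trans (le_runningMax F l)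
  have hm0 : ∀ l, 0 ≤ m l := fun l => (hG0 l).trans (le_runningMax G l)
  have hMi : ∀ e l, M l ≤ M (e :: l) := runningMax_le_cons F
  have hmi : ∀ e l, m l ≤ m (e :: l) := runningMax_le_cons G
  have hui : ∀ e l, m l ^ (2 - s) ≤ m (e :: l) ^ (2 - s) := fun e l =>
    Real.rpow_le_rpow (hm0 l) (hmi e l) (by linarith)
  have hu0 : ∀ l, 0 ≤ m l ^ (2 - s) := fun l => Real.rpow_nonneg (hm0 l) _
  have hsi : ∀ e l, m l ^ s ≤ m (e :: l) ^ s := fun e l =>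
    Real.rpow_le_rpow (hm0 l) (hmi e l) (by linarith)
  have hMmi : ∀ e l, M l * m l ≤ M (e :: l) * m (e :: l) := fun e l =>
    mul_le_mul (hMi e l) (hmi e l) (hm0 l) (hM0 _)
  have d1 := (hasDrift_mul_norm_sq hf hui).const_mul (c := 2) (by norm_num)
  have d2 := (hasDrift_runningMax_rpow hg hG hgG hs hs2).const_mul (c := 2) (by norm_num)
  have d3 := hasDrift_mul_norm_sq hβ (w := fun l => m l ^ (2 - s) * M l ^ 2) (fun e l =>
    mul_le_mul (hui e l) (by have := hMi e l; have := hM0 l; gcongr) (sq_nonneg _) (hu0 _))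
  have d4 := hasDrift_mul_norm_sq hβ hsi
  have d5 := hasDrift_mul_norm_sq hβ hMmi
  have d6 := hasDrift_exit h𝒬 (w := fun l => M l * m l) hMmi
  have d := ((((d1.add d2).add d3).add d4).add d5).add d6
  have hsum := d.sum_le K
  have hkernel : ∀ k, treeMean k (interactionKernel 𝒬 f g β F G) ≤ treeMean k _ := fun k =>
    treeMean_mono k (Ψ := fun l => 2 * (m l ^ (2 - s) *
        ((∑ e, ‖f (e :: l) - f l‖ ^ 2) / Fintype.card ι))
      + 2 * (m l ^ (s - 2) * ((∑ e, ‖g (e :: l) - g l‖ ^ 2) / Fintype.card ι))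
      + (m l ^ (2 - s) * M l ^ 2) * ((∑ e, ‖β (e :: l) - β l‖ ^ 2) / Fintype.card ι)
      + m l ^ s * ((∑ e, ‖β (e :: l) - β l‖ ^ 2) / Fintype.card ι)
      + M l * m l * ((∑ e, ‖β (e :: l) - β l‖ ^ 2) / Fintype.card ι)
      + M l * m l * ((∑ e, exitIndicator 𝒬 l e) / Fintype.card ι)) (fun l => by
    simp only [interactionKernel, ← mul_div_assoc, ← add_div]
    gcongr ?_ / _
    simp only [Finset.mul_sum, ← Finset.sum_add_distrib]
    refine Finset.sum_le_sum fun e _ => ?_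
    refine interaction_le_weighted (hF0 l) (hG0 l) (norm_nonneg _) (norm_nonneg _)
      (norm_nonneg _) (exitIndicator_nonneg l e) (le_runningMax F l) (le_runningMax G l) ?_
    intro hml
    have h1 : G l = 0 := le_antisymm (hml ▸ le_runningMax G l) (hG0 l)
    have h2 : G (e :: l) ≤ 0 := by simpa [h1] using hG.le_card_mul hG0 e l
    have h3 : g l = 0 := norm_le_zero_iff.1 (h1 ▸ hgG l)
    have h4 : g (e :: l) = 0 := norm_le_zero_iff.1 ((hgG _).trans h2)
    simp [h3, h4])
  have hfinal : ∀ l, 2 * (m l ^ (2 - s) * ‖f l‖ ^ 2)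
      + 2 * (m l ^ (s - 2) * ‖g l‖ ^ 2 + N ^ s * m l ^ s)
      + (m l ^ (2 - s) * M l ^ 2) * ‖β l‖ ^ 2 + m l ^ s * ‖β l‖ ^ 2 + M l * m l * ‖β l‖ ^ 2
      + M l * m l * 𝒬ᶜ.indicator 1 l ≤ c * (M l ^ q + m l ^ s) := by
    intro l
    have hx := hM0 l
    have hy := hm0 l
    have hxq : 0 ≤ M l ^ q := Real.rpow_nonneg hx q
    have hys : 0 ≤ m l ^ s := Real.rpow_nonneg hy s
    have i1 : m l ^ (2 - s) * M l ^ 2 ≤ M l ^ q + m l ^ s := by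
      rw [mul_comm]; exact sq_mul_rpow_two_sub_le hqs hs2 hx hy
    have i2 : M l * m l ≤ M l ^ q + m l ^ s := mul_le_rpow_add_rpow hqs hx hy
    have i3 : m l ^ (2 - s) * ‖f l‖ ^ 2 ≤ M l ^ q + m l ^ s := by
      refine le_trans ?_ i1
      have := (hfF l).trans (le_runningMax F l)
      have := hu0 l
      gcongr
    have i4 : m l ^ (s - 2) * ‖g l‖ ^ 2 ≤ m l ^ s := by
      have h1 : ‖g l‖ ≤ m l := (hgG l).trans (le_runningMax G l)
      rcases hy.eq_or_lt with h | h
      · have : ‖g l‖ = 0 := le_antisymm (h ▸ h1) (norm_nonneg _)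
        rw [this]; simpa using hys
      · calc m l ^ (s - 2) * ‖g l‖ ^ 2 ≤ m l ^ (s - 2) * m l ^ 2 := by gcongr
          _ = m l ^ s := by rw [← Real.rpow_natCast, ← Real.rpow_add h]; norm_num
    have i5 : ‖β l‖ ^ 2 ≤ B ^ 2 := by have := hβB l; gcongr
    have i6 : (m l ^ (2 - s) * M l ^ 2) * ‖β l‖ ^ 2 ≤ (M l ^ q + m l ^ s) * B ^ 2 := by gcongr
    have i7 : m l ^ s * ‖β l‖ ^ 2 ≤ (M l ^ q + m l ^ s) * B ^ 2 := by gcongr; linarith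
    have i8 : M l * m l * ‖β l‖ ^ 2 ≤ (M l ^ q + m l ^ s) * B ^ 2 := by gcongr
    have i9 : M l * m l * 𝒬ᶜ.indicator 1 l ≤ (M l ^ q + m l ^ s) * 1 := by
      have h0 : (0 : ℝ) ≤ 𝒬ᶜ.indicator 1 l := Set.indicator_nonneg (by simp) _
      have h1 : 𝒬ᶜ.indicator (1 : List ι → ℝ) l ≤ 1 :=
        Set.indicator_le_self' (f := (1 : List ι → ℝ)) (by intros; norm_num) l
      gcongr
    have i10 : 0 ≤ N ^ s * M l ^ q := by positivity
    rw [hc]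
    linarith
  have hstart : 0 ≤ 2 * (m [] ^ (2 - s) * ‖f []‖ ^ 2)
      + 2 * (m [] ^ (s - 2) * ‖g []‖ ^ 2 + N ^ s * m [] ^ s)
      + (m [] ^ (2 - s) * M [] ^ 2) * ‖β []‖ ^ 2 + m [] ^ s * ‖β []‖ ^ 2
      + M [] * m [] * ‖β []‖ ^ 2 + M [] * m [] * 𝒬ᶜ.indicator 1 [] := by
    have := hM0 []
    have := hm0 []
    have : (0 : ℝ) ≤ 𝒬ᶜ.indicator 1 [] := Set.indicator_nonneg (by simp) _
    positivity
  have hq' := hD₁ F hF hF0 K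
  have hs' := hD₂ G hG hG0 K
  have hFq : 0 ≤ treeMean K (fun l => F l ^ q) :=
    treeMean_nonneg K fun l => Real.rpow_nonneg (hF0 l) q
  have hGs : 0 ≤ treeMean K (fun l => G l ^ s) :=
    treeMean_nonneg K fun l => Real.rpow_nonneg (hG0 l) s
  calc _ ≤ _ := Finset.sum_le_sum fun k _ => hkernel k
    _ ≤ _ := le_of_add_le_of_nonneg_right hsum hstart
    _ ≤ treeMean K (fun l => c * (M l ^ q + m l ^ s)) := treeMean_mono K hfinal
    _ = c * (treeMean K (fun l => M l ^ q) + treeMean K (fun l => m l ^ s)) := by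
        rw [treeMean_const_mul, treeMean_add]
    _ ≤ c * (C₁ * treeMean K (fun l => F l ^ q) + C₂ * treeMean K (fun l => G l ^ s)) := by
        gcongr
    _ ≤ c * ((C₁ + C₂) * treeMean K (fun l => F l ^ q)
          + (C₁ + C₂) * treeMean K (fun l => G l ^ s)) := by
        gcongr <;> linarith
    _ = _ := by ring

/-- **The bilinear estimate on the tree**, for all exponents. -/
lemma sum_treeMean_interactionKernel_le [Nonempty ι] {q s : ℝ}
    (hqs : q.HolderConjugate s) {B : ℝ} :
    ∃ C : ℝ, 0 < C ∧ ∀ 𝒬 : Set (List ι), (∀ e l, e :: l ∈ 𝒬 → l ∈ 𝒬) →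
      ∀ (f g β : List ι → 𝕜) (F G : List ι → ℝ), IsTreeMartingale f → IsTreeMartingale g →
      IsTreeMartingale β → IsTreeMartingale F → IsTreeMartingale G →
      (∀ l, ‖f l‖ ≤ F l) → (∀ l, ‖g l‖ ≤ G l) → (∀ l, ‖β l‖ ≤ B) → ∀ K,
      ∑ k ∈ Finset.range K, treeMean k (interactionKernel 𝒬 f g β F G)
        ≤ C * (treeMean K (fun l => F l ^ q) + treeMean K (fun l => G l ^ s)) := by
  rcases le_total s 2 with hs2 | hs2
  · exact sum_treeMean_interactionKernel_le_of_le_two hqs hs2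
  · have hq2 : q ≤ 2 := by
      by_contra! h
      have := hqs.mul_eq_add
      nlinarith
    obtain ⟨C, hC, h⟩ := sum_treeMean_interactionKernel_le_of_le_two (ι := ι) (𝕜 := 𝕜)
      hqs.symm hq2
    refine ⟨C, hC, fun 𝒬 h𝒬 f g β F G hf hg hβ hF hG hfF hgG hβB K => ?_⟩
    rw [interactionKernel_comm, add_comm]
    exact h 𝒬 h𝒬 g f β G F hg hf hβ hG hF hgG hfF hβB K

open Classical in
/-- The pairing of one half-twisted difference with `g` is controlled by the interaction kernel.
The first order part `(f' - f) / b - f (b' - b) / b ^ 2` of a coefficient has mean zero over all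
children, so it meets the increment of `g` only, up to the contribution of the exits. -/
lemma norm_sum_halfTwisted_le [Nonempty ι] {δ B : ℝ} (hδ : 0 < δ) (hB : 0 ≤ B) :
    ∃ C : ℝ, 0 < C ∧ ∀ 𝒬 : Set (List ι), (∀ e l, e :: l ∈ 𝒬 → l ∈ 𝒬) →
      ∀ (f g b : List ι → 𝕜) (F G : List ι → ℝ), IsTreeMartingale f →
      IsTreeMartingale b → IsTreeMartingale F → IsTreeMartingale G →
      (∀ l, ‖f l‖ ≤ F l) → (∀ l, ‖g l‖ ≤ G l) → (∀ l ∈ 𝒬, δ ≤ ‖b l‖) → ‖b []‖ ≤ B →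
      (∀ l ∈ 𝒬, ∀ e, ‖b (e :: l)‖ ≤ B) → ∀ l ∈ 𝒬,
      ‖∑ e, (if e :: l ∈ 𝒬 then g (e :: l) * (f (e :: l) / b (e :: l) - f l / b l) else 0)‖
          / Fintype.card ι
        ≤ C * interactionKernel 𝒬 f g (stoppedProcessOn 𝒬 b) F G l := by
  set N : ℝ := (Fintype.card ι : ℝ) with hN
  have hN0 : 0 < N := card_pos_real
  obtain ⟨D, hD⟩ : ∃ D, D = δ⁻¹ := ⟨_, rfl⟩
  have hD0 : 0 < D := by rw [hD]; positivity
  set C := D + D ^ 2 + N * D ^ 2 + N * D ^ 3 + (N + 1) * D + 2 * B * D ^ 2 with hC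
  refine ⟨C, by positivity, ?_⟩
  intro 𝒬 h𝒬 f g b F G hf hb hF hG hfF hgG hδb hb0 hbB l hl
  have hF0 : ∀ l, 0 ≤ F l := fun l => (norm_nonneg _).trans (hfF l)
  have hG0 : ∀ l, 0 ≤ G l := fun l => (norm_nonneg _).trans (hgG l)
  have hbl : b l ≠ 0 := norm_pos_iff.1 (hδ.trans_le (hδb l hl))
  have hinv : ∀ l ∈ 𝒬, ‖(b l)⁻¹‖ ≤ D := fun l hl => by
    rw [norm_inv, hD]; exact inv_anti₀ hδ (hδb l hl)
  -- The first order part of `f' / b' - f / b`.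
  set L : ι → 𝕜 := fun e =>
    (f (e :: l) - f l) * (b l)⁻¹ - f l * (b (e :: l) - b l) * ((b l)⁻¹) ^ 2 with hL
  have hLsum : ∑ e, L e = 0 := by
    have h1 : ∑ e, (f (e :: l) - f l) = 0 := by
      rw [Finset.sum_sub_distrib, hf l]; simp
    have h2 : ∑ e, (b (e :: l) - b l) = 0 := by
      rw [Finset.sum_sub_distrib, hb l]; simp
    rw [hL, Finset.sum_sub_distrib, ← Finset.sum_mul, ← Finset.sum_mul, ← Finset.mul_sum, h1, h2]
    simp
  have hLn : ∀ e, ‖L e‖ ≤ ‖f (e :: l) - f l‖ * D + F l * ‖b (e :: l) - b l‖ * D ^ 2 := fun e => by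
    refine (norm_sub_le _ _).trans ?_
    rw [norm_mul, norm_mul, norm_mul, norm_pow]
    have := hinv l hl
    have := hfF l
    have := hF0 l
    gcongr
  have hsub : ∑ e, (if e :: l ∈ 𝒬 then g (e :: l) * (f (e :: l) / b (e :: l) - f l / b l) else 0)
      = ∑ e, ((if e :: l ∈ 𝒬 then g (e :: l) * (f (e :: l) / b (e :: l) - f l / b l) else 0)
        - g l * L e) := by
    rw [Finset.sum_sub_distrib, ← Finset.mul_sum, hLsum, mul_zero, sub_zero]
  rw [hsub, interactionKernel, ← mul_div_assoc]
  gcongr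
  refine (norm_sum_le _ _).trans ?_
  rw [Finset.mul_sum]
  refine Finset.sum_le_sum fun e _ => ?_
  rw [stoppedProcessOn_cons_of_mem hl, stoppedProcessOn_of_mem h𝒬 hl]
  have hFe := hF.le_card_mul hF0 e l
  have hGe := hG.le_card_mul hG0 e l
  have hfl := hF0 l
  have hgl := hG0 l
  obtain ⟨a, ha⟩ : ∃ a, a = ‖f (e :: l) - f l‖ := ⟨_, rfl⟩
  obtain ⟨c, hc⟩ : ∃ c, c = ‖g (e :: l) - g l‖ := ⟨_, rfl⟩
  obtain ⟨d, hd⟩ : ∃ d, d = ‖b (e :: l) - b l‖ := ⟨_, rfl⟩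
  have ha0 : 0 ≤ a := ha ▸ norm_nonneg _
  have hc0 : 0 ≤ c := hc ▸ norm_nonneg _
  have hd0 : 0 ≤ d := hd ▸ norm_nonneg _
  have hLe := hLn e
  rw [← ha, ← hd] at hLe
  split_ifs with hel
  · have hbe : b (e :: l) ≠ 0 := norm_pos_iff.1 (hδ.trans_le (hδb _ hel))
    have hx : exitIndicator 𝒬 l e = 0 := by simp [exitIndicator, hel]
    have hid : g (e :: l) * (f (e :: l) / b (e :: l) - f l / b l) - g l * L e
        = (g (e :: l) - g l) * L e
          + g (e :: l) * (f l * (b (e :: l) - b l) ^ 2 * ((b l)⁻¹) ^ 2 * (b (e :: l))⁻¹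
            - (f (e :: l) - f l) * (b (e :: l) - b l) * (b l)⁻¹ * (b (e :: l))⁻¹) := by
      simp only [hL]
      field_simp
      ring
    rw [hid, hx, ← ha, ← hc, ← hd]
    have n1 : ‖(g (e :: l) - g l) * L e‖ ≤ c * (a * D + F l * d * D ^ 2) := by
      rw [norm_mul, ← hc]; gcongr
    have n2 : ‖g (e :: l) * (f l * (b (e :: l) - b l) ^ 2 * ((b l)⁻¹) ^ 2 * (b (e :: l))⁻¹
            - (f (e :: l) - f l) * (b (e :: l) - b l) * (b l)⁻¹ * (b (e :: l))⁻¹)‖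
        ≤ N * G l * (F l * d ^ 2 * D ^ 2 * D + a * d * D * D) := by
      rw [norm_mul]
      have := (hgG (e :: l)).trans hGe
      have i1 := hinv l hl
      have i2 := hinv _ hel
      have i3 := hfF l
      gcongr
      refine (norm_sub_le _ _).trans ?_
      simp only [norm_mul, norm_pow, ← ha, ← hd]
      gcongr
    refine (norm_add_le _ _).trans ((add_le_add n1 n2).trans ?_)
    have j1 : c * a * D ≤ c * a * C := by
      gcongr; rw [hC]; have : 0 ≤ D ^ 2 + N * D ^ 2 + N * D ^ 3 + (N + 1) * D + 2 * B * D ^ 2 := by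
        positivity
      linarith
    have j2 : c * F l * d * D ^ 2 ≤ c * F l * d * C := by
      gcongr; rw [hC]; have : 0 ≤ D + N * D ^ 2 + N * D ^ 3 + (N + 1) * D + 2 * B * D ^ 2 := by
        positivity
      linarith
    have j3 : G l * F l * d ^ 2 * (N * D ^ 3) ≤ G l * F l * d ^ 2 * C := by
      gcongr; rw [hC]; have : 0 ≤ D + D ^ 2 + N * D ^ 2 + (N + 1) * D + 2 * B * D ^ 2 := by
        positivity
      linarith
    have j4 : G l * a * d * (N * D ^ 2) ≤ G l * a * d * C := by
      gcongr; rw [hC]; have : 0 ≤ D + D ^ 2 + N * D ^ 3 + (N + 1) * D + 2 * B * D ^ 2 := by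
        positivity
      linarith
    linarith
  · have hx : exitIndicator 𝒬 l e = 1 := by simp [exitIndicator, hl, hel]
    rw [hx, zero_sub, norm_neg, norm_mul, ← ha, ← hc, ← hd]
    have haF : a ≤ (N + 1) * F l := by
      rw [ha]
      refine (norm_sub_le _ _).trans ?_
      linarith [hfF (e :: l), hfF l]
    have hdB : d ≤ 2 * B := by
      have hB' := norm_stoppedProcessOn_le hb0 hbB l
      rw [stoppedProcessOn_of_mem h𝒬 hl] at hB'
      rw [hd]
      refine (norm_sub_le _ _).trans ?_
      linarith [hbB l hl e]
    have h1 : ‖g l‖ * ‖L e‖ ≤ G l * ((N + 1) * F l * D + F l * (2 * B) * D ^ 2) := by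
      have := hgG l
      gcongr
      refine hLe.trans ?_
      gcongr
    have h2 : G l * F l * ((N + 1) * D + 2 * B * D ^ 2) ≤ G l * F l * C := by
      gcongr; rw [hC]; have : 0 ≤ D + D ^ 2 + N * D ^ 2 + N * D ^ 3 := by positivity
      linarith
    have h3 : 0 ≤ C * (a * c + (F l * c + G l * a) * d + F l * G l * d ^ 2) := by positivity
    linarith

end TreeEstimate

/-! ### Dyadic cubes, averages and stopping cubes -/

namespace DyadicCube

variable {n : ℕ}

lemma mem_toSet_iff {Q : DyadicCube n} {x : Fin n → ℝ} :
    x ∈ Q.toSet ↔ ∀ i, ⌊x i * (2 : ℝ) ^ Q.generation⌋ = Q.position i := by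
  have h2 : (0 : ℝ) < 2 ^ Q.generation := by positivity
  simp only [toSet, Set.mem_ofPred_eq, Set.mem_Ico, Int.floor_eq_iff, zpow_neg, ← div_eq_mul_inv,
    div_le_iff₀ h2, lt_div_iff₀ h2]

lemma toSet_eq_pi (Q : DyadicCube n) : Q.toSet = Set.univ.pi fun i =>
    Set.Ico ((Q.position i : ℝ) * (2 : ℝ) ^ (-Q.generation))
      (((Q.position i : ℝ) + 1) * (2 : ℝ) ^ (-Q.generation)) := by
  ext x
  simp [toSet]

lemma measurableSet_toSet (Q : DyadicCube n) : MeasurableSet Q.toSet := by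
  rw [toSet_eq_pi]
  exact MeasurableSet.univ_pi fun i => measurableSet_Ico

lemma volume_toSet (Q : DyadicCube n) :
    volume Q.toSet = ENNReal.ofReal (((2 : ℝ) ^ (-Q.generation)) ^ n) := by
  rw [toSet_eq_pi, Real.volume_pi_Ico]
  simp only [add_mul, one_mul, add_sub_cancel_left, Finset.prod_const, Finset.card_univ,
    Fintype.card_fin]
  rw [ENNReal.ofReal_pow (by positivity)]

lemma volume_toSet_lt_top (Q : DyadicCube n) : volume Q.toSet < ⊤ := by
  rw [volume_toSet]; exact ENNReal.ofReal_lt_top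

lemma volumeReal_toSet (Q : DyadicCube n) :
    volume.real Q.toSet = ((2 : ℝ) ^ (-Q.generation)) ^ n := by
  rw [Measure.real, volume_toSet, ENNReal.toReal_ofReal (by positivity)]

lemma volumeReal_toSet_pos (Q : DyadicCube n) : 0 < volume.real Q.toSet := by
  rw [volumeReal_toSet]; positivity

lemma card_fin_two : (Fintype.card (Fin n → Fin 2) : ℝ) = 2 ^ n := by simp

lemma volumeReal_child (Q : DyadicCube n) (e : Fin n → Fin 2) :
    Fintype.card (Fin n → Fin 2) * volume.real (Q.child e).toSet = volume.real Q.toSet := by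
  rw [card_fin_two, volumeReal_toSet, volumeReal_toSet, ← mul_pow]
  congr 1
  simp only [child, neg_add, zpow_add₀ (two_ne_zero : (2 : ℝ) ≠ 0)]
  norm_num
  ring

lemma nonempty_toSet (Q : DyadicCube n) : Q.toSet.Nonempty := by
  refine ⟨fun i => Q.position i * (2 : ℝ) ^ (-Q.generation), mem_toSet_iff.2 fun i => ?_⟩
  rw [mul_assoc, ← zpow_add₀ two_ne_zero]
  simp

/-- The dyadic nesting property. -/
lemma toSet_subset_of_mem {Q R : DyadicCube n} {x : Fin n → ℝ} (hQ : x ∈ Q.toSet)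
    (hR : x ∈ R.toSet) (h : R.generation ≤ Q.generation) : Q.toSet ⊆ R.toSet := by
  intro y hy
  rw [mem_toSet_iff] at *
  intro i
  obtain ⟨d, hd⟩ := Int.eq_ofNat_of_zero_le (sub_nonneg.2 h)
  have key : ∀ t : ℝ, t * (2 : ℝ) ^ R.generation
      = t * (2 : ℝ) ^ Q.generation / ((2 ^ d : ℕ) : ℝ) := by
    intro t
    have : Q.generation = R.generation + d := by linarith
    rw [this, zpow_add₀ two_ne_zero, zpow_natCast]
    push_cast
    field_simp
  rw [← hR i, key, key, Int.floor_div_natCast, Int.floor_div_natCast, hQ i, hy i]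

lemma generation_le_of_subset (hn : 1 ≤ n) {Q R : DyadicCube n} (h : Q.toSet ⊆ R.toSet) :
    R.generation ≤ Q.generation := by
  have h1 : volume.real Q.toSet ≤ volume.real R.toSet :=
    measureReal_mono h R.volume_toSet_lt_top.ne
  rw [volumeReal_toSet, volumeReal_toSet,
    pow_le_pow_iff_left₀ (by positivity) (by positivity) (by lia),
    zpow_le_zpow_iff_right₀ one_lt_two] at h1
  lia

lemma eq_of_mem {Q R : DyadicCube n} {x : Fin n → ℝ} (hQ : x ∈ Q.toSet)
    (hR : x ∈ R.toSet) (h : Q.generation = R.generation) : Q = R := by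
  rw [mem_toSet_iff] at *
  refine DyadicCube.ext h (funext fun i => ?_)
  rw [← hQ i, ← hR i, h]

lemma eq_of_subset {Q R : DyadicCube n} (h : Q.toSet ⊆ R.toSet)
    (hg : Q.generation = R.generation) : Q = R := by
  obtain ⟨x, hx⟩ := Q.nonempty_toSet
  exact eq_of_mem hx (h hx) hg

/-- The dyadic cube of which a given cube is a child. -/
def parent (Q : DyadicCube n) : DyadicCube n where
  generation := Q.generation - 1
  position := fun i => Q.position i / 2

lemma toSet_subset_parent (Q : DyadicCube n) : Q.toSet ⊆ Q.parent.toSet := by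
  intro x hx
  rw [mem_toSet_iff] at *
  intro i
  have : x i * (2 : ℝ) ^ Q.parent.generation = x i * (2 : ℝ) ^ Q.generation / ((2 : ℕ) : ℝ) := by
    simp only [parent, zpow_sub₀ (two_ne_zero : (2 : ℝ) ≠ 0)]
    norm_num
    ring
  rw [this, Int.floor_div_natCast, hx i]
  rfl

lemma parent_child (Q : DyadicCube n) (e : Fin n → Fin 2) : (Q.child e).parent = Q := by
  refine DyadicCube.ext (by simp [parent, child]) (funext fun i => ?_)
  simp only [parent, child]
  have := (e i).isLt
  lia

lemma exists_child_parent (Q : DyadicCube n) : ∃ e, Q.parent.child e = Q := by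
  refine ⟨fun i => ⟨(Q.position i % 2).toNat, by lia⟩, ?_⟩
  refine DyadicCube.ext (by simp [parent, child]) (funext fun i => ?_)
  simp only [parent, child]
  lia

lemma child_subset (Q : DyadicCube n) (e : Fin n → Fin 2) : (Q.child e).toSet ⊆ Q.toSet := by
  have := toSet_subset_parent (Q.child e)
  rwa [parent_child] at this

lemma child_injective (Q : DyadicCube n) : Function.Injective Q.child := by
  intro e e' h
  funext i
  have := congrFun (congrArg position h) i
  simp only [child] at this
  exact Fin.ext (by lia)

lemma pairwise_disjoint_child (Q : DyadicCube n) :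
    Pairwise (Function.onFun Disjoint fun e => (Q.child e).toSet) := by
  intro e e' hne
  rw [Function.onFun, Set.disjoint_left]
  exact fun x hx hx' => hne (Q.child_injective (eq_of_mem hx hx' rfl))

lemma iUnion_child (Q : DyadicCube n) : ⋃ e, (Q.child e).toSet = Q.toSet := by
  refine Set.Subset.antisymm (Set.iUnion_subset Q.child_subset) fun x hx => ?_
  let R : DyadicCube n :=
    ⟨Q.generation + 1, fun i => ⌊x i * (2 : ℝ) ^ (Q.generation + 1)⌋⟩
  have hR : x ∈ R.toSet := mem_toSet_iff.2 fun i => rfl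
  obtain ⟨e, he⟩ := R.exists_child_parent
  have : R.parent = Q := eq_of_mem (R.toSet_subset_parent hR) hx (by simp [R, parent])
  rw [this] at he
  exact Set.mem_iUnion.2 ⟨e, he ▸ hR⟩

/-- A child contained in a dyadic cube `T` is equal to `T`, or its parent is contained in `T`. -/
lemma child_eq_or_subset (hn : 1 ≤ n) {Q T : DyadicCube n} {e : Fin n → Fin 2}
    (h : (Q.child e).toSet ⊆ T.toSet) : Q.child e = T ∨ Q.toSet ⊆ T.toSet := by
  have hg := generation_le_of_subset hn h
  rcases hg.eq_or_lt with hg | hg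
  · exact Or.inl (eq_of_subset h hg.symm)
  · right
    obtain ⟨x, hx⟩ := (Q.child e).nonempty_toSet
    refine toSet_subset_of_mem (Q.child_subset e hx) (h hx) ?_
    simp only [child] at hg
    lia

/-- The cube reached from `S` by choosing children along a word. The last choice is the head of
the word. -/
def descendant (S : DyadicCube n) : List (Fin n → Fin 2) → DyadicCube n
  | [] => S
  | e :: l => (descendant S l).child e

lemma descendant_subset (S : DyadicCube n) (l : List (Fin n → Fin 2)) :
    (S.descendant l).toSet ⊆ S.toSet := by
  induction l with
  | nil => exact subset_rfl
  | cons e l ih => exact (child_subset _ e).trans ih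

lemma exists_descendant_eq (hn : 1 ≤ n) {S Q : DyadicCube n} (h : Q.toSet ⊆ S.toSet) :
    ∃ l, S.descendant l = Q := by
  obtain ⟨d, hd⟩ := Int.eq_ofNat_of_zero_le (sub_nonneg.2 (generation_le_of_subset hn h))
  induction d generalizing Q with
  | zero => exact ⟨[], (eq_of_subset h (by simpa [sub_eq_zero] using hd)).symm⟩
  | succ d ih =>
    obtain ⟨x, hx⟩ := Q.nonempty_toSet
    have hp : Q.parent.toSet ⊆ S.toSet :=
      toSet_subset_of_mem (Q.toSet_subset_parent hx) (h hx) (by simp only [parent]; lia)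
    obtain ⟨l, hl⟩ := ih hp (by simp only [parent]; lia)
    obtain ⟨e, he⟩ := Q.exists_child_parent
    exact ⟨e :: l, by rw [descendant, hl, he]⟩

lemma volumeReal_descendant (S : DyadicCube n) (l : List (Fin n → Fin 2)) :
    (Fintype.card (Fin n → Fin 2) : ℝ) ^ l.length * volume.real (S.descendant l).toSet
      = volume.real S.toSet := by
  induction l with
  | nil => simp [descendant]
  | cons e l ih => rw [List.length_cons, pow_succ, mul_assoc, descendant, volumeReal_child, ih]

/-- A sum over finitely many dyadic subcubes of `S`, weighted by volume, is at most the sum of the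
means over all generations up to some depth. -/
lemma exists_sum_volume_le (hn : 1 ≤ n) (S : DyadicCube n) (F : Finset (DyadicCube n))
    (hF : ∀ Q ∈ F, Q.toSet ⊆ S.toSet) :
    ∃ K, ∀ Φ : List (Fin n → Fin 2) → ℝ, (∀ l, 0 ≤ Φ l) → ∀ Ψ : DyadicCube n → ℝ,
      (∀ l, S.descendant l ∈ F → Ψ (S.descendant l) ≤ Φ l) →
      ∑ Q ∈ F, volume.real Q.toSet * Ψ Q
        ≤ volume.real S.toSet * ∑ k ∈ Finset.range K, treeMean k Φ := by
  classical
  have hex : ∀ Q : F, ∃ l, S.descendant l = Q := fun Q => exists_descendant_eq hn (hF Q Q.2)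
  choose w hw using hex
  obtain ⟨K, hK⟩ : ∃ K, ∀ Q : F, (w Q).length < K := by
    obtain ⟨K, hK⟩ := (Finset.univ.image fun Q : F => (w Q).length).bddAbove
    exact ⟨K + 1, fun Q => Nat.lt_succ_of_le (hK (by simp))⟩
  refine ⟨K, fun Φ hΦ Ψ hΨ => ?_⟩
  have hinj : Function.Injective w := fun Q Q' h => by
    apply Subtype.ext; rw [← hw Q, ← hw Q', h]
  rw [← Finset.sum_coe_sort F, Finset.mul_sum]
  set L := Finset.univ.image w with hL
  calc ∑ Q : F, volume.real (Q : DyadicCube n).toSet * Ψ Q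
      ≤ ∑ Q : F, volume.real (S.descendant (w Q)).toSet * Φ (w Q) := by
        refine Finset.sum_le_sum fun Q _ => ?_
        rw [hw Q]
        have := hΨ (w Q) (by rw [hw Q]; exact Q.2)
        rw [hw Q] at this
        gcongr
    _ = ∑ l ∈ L, volume.real (S.descendant l).toSet * Φ l := by
        rw [hL, Finset.sum_image fun x _ y _ h => hinj h]
    _ = ∑ k ∈ Finset.range K, ∑ l ∈ L with l.length = k,
          volume.real (S.descendant l).toSet * Φ l := by
        refine (Finset.sum_fiberwise_of_maps_to (fun l hl => ?_) _).symm
        obtain ⟨Q, -, rfl⟩ := Finset.mem_image.1 hl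
        exact Finset.mem_range.2 (hK Q)
    _ ≤ _ := Finset.sum_le_sum fun k _ => ?_
  set N : ℝ := (Fintype.card (Fin n → Fin 2) : ℝ) with hN
  have hN0 : 0 < N := card_pos_real
  calc ∑ l ∈ L with l.length = k, volume.real (S.descendant l).toSet * Φ l
      = ∑ l ∈ L with l.length = k, volume.real S.toSet / N ^ k * Φ l := by
        refine Finset.sum_congr rfl fun l hl => ?_
        rw [← S.volumeReal_descendant l, (Finset.mem_filter.1 hl).2, ← hN]
        field_simp
    _ = volume.real S.toSet / N ^ k * ∑ l ∈ L with l.length = k, Φ l := by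
        rw [Finset.mul_sum]
    _ ≤ volume.real S.toSet / N ^ k * (N ^ k * treeMean k Φ) := by
        gcongr
        exact sum_le_treeMean k hΦ _ fun l hl => (Finset.mem_filter.1 hl).2
    _ = _ := by field_simp

end DyadicCube

section CubeAverages

open DyadicCube

variable {n : ℕ} {𝕜 : Type*} [RCLike 𝕜]

lemma cubeAverage_mul_volume (f : (Fin n → ℝ) → 𝕜) (Q : DyadicCube n) :
    cubeAverage f Q * (volume.real Q.toSet : ℝ) = ∫ x in Q.toSet, f x := by
  rw [cubeAverage, setAverage_eq, RCLike.real_smul_eq_coe_mul, mul_comm, ← mul_assoc,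
    ← RCLike.ofReal_mul, mul_inv_cancel₀ Q.volumeReal_toSet_pos.ne']
  simp

lemma norm_cubeAverage_le (f : (Fin n → ℝ) → 𝕜) (Q : DyadicCube n) :
    ‖cubeAverage f Q‖ ≤ cubeAverage (fun x => ‖f x‖) Q := by
  rw [cubeAverage, cubeAverage, setAverage_eq, setAverage_eq, norm_smul, smul_eq_mul, norm_inv,
    Real.norm_of_nonneg measureReal_nonneg]
  gcongr
  exact norm_integral_le_integral_norm _

lemma cubeAverage_nonneg {f : (Fin n → ℝ) → ℝ} (hf : ∀ x, 0 ≤ f x) (Q : DyadicCube n) :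
    0 ≤ cubeAverage f Q := by
  rw [cubeAverage, setAverage_eq]
  exact smul_nonneg (by positivity) (integral_nonneg hf)

lemma isTreeMartingale_cubeAverage (S : DyadicCube n) {f : (Fin n → ℝ) → 𝕜}
    (hf : ∀ Q : DyadicCube n, IntegrableOn f Q.toSet) :
    IsTreeMartingale fun l => cubeAverage f (S.descendant l) := by
  intro l
  set Q := S.descendant l with hQ
  have hv : ((volume.real Q.toSet : ℝ) : 𝕜) ≠ 0 := by
    exact_mod_cast Q.volumeReal_toSet_pos.ne'
  apply mul_right_cancel₀ hv
  rw [mul_assoc, cubeAverage_mul_volume, ← Q.iUnion_child,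
    integral_iUnion_fintype (fun e => (Q.child e).measurableSet_toSet) Q.pairwise_disjoint_child
      (fun e => hf _), Finset.sum_mul, Q.iUnion_child,
    Finset.mul_sum]
  refine Finset.sum_congr rfl fun e _ => ?_
  rw [← cubeAverage_mul_volume, ← volumeReal_child Q e]
  simp only [descendant, ← hQ]
  push_cast
  ring

lemma MeasureTheory.MemLp.integrableOn_cube {f : (Fin n → ℝ) → 𝕜} {q : ℝ} (hq : 1 < q)
    (hf : MemLp f (ENNReal.ofReal q)) (Q : DyadicCube n) : IntegrableOn f Q.toSet := by
  have : IsFiniteMeasure (volume.restrict Q.toSet) :=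
    ⟨by simpa using Q.volume_toSet_lt_top⟩
  exact (hf.restrict _).integrable (by simpa using hq.le)

lemma MeasureTheory.MemLp.integrable_norm_rpow_of_pos {α : Type*} [MeasurableSpace α]
    {μ : Measure α} {h : α → 𝕜} {q : ℝ} (hq : 0 < q) (hh : MemLp h (ENNReal.ofReal q) μ) :
    Integrable (fun x => ‖h x‖ ^ q) μ := by
  have := hh.integrable_norm_rpow (by simpa using hq) ENNReal.ofReal_ne_top
  rwa [ENNReal.toReal_ofReal hq.le] at this

/-- Jensen's inequality on a cube. -/
lemma cubeAverage_norm_rpow_le {f : (Fin n → ℝ) → 𝕜} {q : ℝ} (hq : 1 < q)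
    (hf : MemLp f (ENNReal.ofReal q)) (Q : DyadicCube n) :
    cubeAverage (fun x => ‖f x‖) Q ^ q ≤ cubeAverage (fun x => ‖f x‖ ^ q) Q := by
  have h := (convexOn_rpow hq.le).map_set_average_le (μ := volume) (t := Q.toSet)
    (f := fun x => ‖f x‖) (Real.continuous_rpow_const (by linarith)).continuousOn isClosed_Ici
    (fun h => Q.volumeReal_toSet_pos.ne' (by simp [Measure.real, h]))
    Q.volume_toSet_lt_top.ne (ae_of_all _ fun x => norm_nonneg _)
    (hf.integrableOn_cube hq Q).norm (hf.integrable_norm_rpow_of_pos (by linarith)).integrableOn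
  exact h

/-- The conditional expectations of `|f|` do not have a larger `L^q` norm than `f`. -/
lemma treeMean_cubeAverage_norm_rpow_le (S : DyadicCube n) {f : (Fin n → ℝ) → 𝕜} {q : ℝ}
    (hq : 1 < q) (hf : MemLp f (ENNReal.ofReal q)) (K : ℕ) :
    volume.real S.toSet *
      treeMean K (fun l => cubeAverage (fun x => ‖f x‖) (S.descendant l) ^ q)
      ≤ ∫ x, ‖f x‖ ^ q := by
  have hi := hf.integrable_norm_rpow_of_pos (by linarith)
  have hm : IsTreeMartingale fun l => cubeAverage (fun x => ‖f x‖ ^ q) (S.descendant l) :=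
    isTreeMartingale_cubeAverage S fun Q => hi.integrableOn
  have h1 := treeMean_mono K fun l => cubeAverage_norm_rpow_le hq hf (S.descendant l)
  rw [treeMean_martingale hm K] at h1
  have h2 := cubeAverage_mul_volume (fun x => ‖f x‖ ^ q) S
  have h3 : ∫ x in S.toSet, ‖f x‖ ^ q ≤ ∫ x, ‖f x‖ ^ q :=
    setIntegral_le_integral hi (ae_of_all _ fun x => by positivity)
  calc _ ≤ volume.real S.toSet * cubeAverage (fun x => ‖f x‖ ^ q) S := by
        gcongr; exact h1
    _ ≤ _ := by rw [mul_comm]; exact h2.trans_le h3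

end CubeAverages

section StoppingCubes

open DyadicCube

variable {n : ℕ} {𝕜 : Type*} [RCLike 𝕜] {S₀ : DyadicCube n} {b : (Fin n → ℝ) → 𝕜}
  {p A δ : ℝ} {𝒯 : Set (DyadicCube n)}

lemma exists_maximalStoppingCube (hn : 1 ≤ n) {R : DyadicCube n} (hR : R.toSet ⊆ S₀.toSet)
    (hs : IsStoppingCube b p A δ R) :
    ∃ T ∈ maximalStoppingCubes S₀ b p A δ, R.toSet ⊆ T.toSet := by
  classical
  -- The coarsest stopping cube between `R` and `S₀` is maximal.
  let P : ℕ → Prop := fun d => ∃ T : DyadicCube n, T.toSet ⊆ S₀.toSet ∧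
    IsStoppingCube b p A δ T ∧ R.toSet ⊆ T.toSet ∧ T.generation = S₀.generation + d
  have hP : ∃ d, P d := by
    obtain ⟨d, hd⟩ := Int.eq_ofNat_of_zero_le (sub_nonneg.2 (generation_le_of_subset hn hR))
    exact ⟨d, R, hR, hs, subset_rfl, by lia⟩
  obtain ⟨T, hT₀, hTs, hRT, hTg⟩ := Nat.find_spec hP
  refine ⟨T, ⟨hT₀, hTs, fun U hU hUs hTU => ?_⟩, hRT⟩
  have h1 := generation_le_of_subset hn hTU
  have h2 := generation_le_of_subset hn hU
  obtain ⟨d, hd⟩ := Int.eq_ofNat_of_zero_le (sub_nonneg.2 h2)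
  have h3 : Nat.find hP ≤ d := Nat.find_min' hP ⟨U, hU, hUs, hRT.trans hTU, by lia⟩
  exact (eq_of_subset hTU (by lia)).symm

lemma not_isStoppingCube_of_mem (hn : 1 ≤ n) (h𝒯 : IsTerminalFamily S₀ b p A δ 𝒯)
    {Q : DyadicCube n} (hQ : Q ∈ nonterminalCubes S₀ 𝒯) : ¬ IsStoppingCube b p A δ Q := by
  intro hs
  obtain ⟨T', hT', hQT'⟩ := exists_maximalStoppingCube hn hQ.1 hs
  obtain ⟨T, hT, hT'T⟩ := h𝒯.cover T' hT'
  exact hQ.2 T hT (hQT'.trans hT'T)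

lemma child_mem_nonterminalCubes_iff (hn : 1 ≤ n) {Q : DyadicCube n}
    (hQ : Q ∈ nonterminalCubes S₀ 𝒯) (e : Fin n → Fin 2) :
    Q.child e ∈ nonterminalCubes S₀ 𝒯 ↔ Q.child e ∉ 𝒯 := by
  refine ⟨fun h hT => h.2 _ hT subset_rfl, fun h => ⟨(Q.child_subset e).trans hQ.1, ?_⟩⟩
  intro T hT hsub
  rcases child_eq_or_subset hn hsub with h' | h'
  · exact h (h' ▸ hT)
  · exact hQ.2 T hT h'

lemma mem_nonterminalCubes_of_child {S Q : DyadicCube n} (hQ : Q.toSet ⊆ S.toSet)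
    {e : Fin n → Fin 2} (h : Q.child e ∈ nonterminalCubes S 𝒯) : Q ∈ nonterminalCubes S 𝒯 :=
  ⟨hQ, fun T hT hsub => h.2 T hT ((Q.child_subset e).trans hsub)⟩

lemma le_norm_cubeAverage_of_mem (hn : 1 ≤ n) (h𝒯 : IsTerminalFamily S₀ b p A δ 𝒯)
    {Q : DyadicCube n} (hQ : Q ∈ nonterminalCubes S₀ 𝒯) : δ ≤ ‖cubeAverage b Q‖ := by
  have h := not_isStoppingCube_of_mem hn h𝒯 hQ
  rw [IsStoppingCube, not_or, not_le, ← cubeAverage_mul_volume, norm_mul, RCLike.norm_ofReal,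
    abs_of_pos Q.volumeReal_toSet_pos] at h
  exact (lt_of_mul_lt_mul_right h.1 Q.volumeReal_toSet_pos.le).le

lemma cubeAverage_norm_le_of_mem (hn : 1 ≤ n) (hp : 1 < p) (hb : MemLp b (ENNReal.ofReal p))
    (h𝒯 : IsTerminalFamily S₀ b p A δ 𝒯) {Q : DyadicCube n}
    (hQ : Q ∈ nonterminalCubes S₀ 𝒯) :
    cubeAverage (fun x => ‖b x‖) Q ≤ |δ⁻¹ * A ^ p| ^ (1 / p) := by
  have h := not_isStoppingCube_of_mem hn h𝒯 hQ
  rw [IsStoppingCube, not_or, not_le, not_le] at h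
  have h1 : cubeAverage (fun x => ‖b x‖ ^ p) Q * volume.real Q.toSet
      = ∫ x in Q.toSet, ‖b x‖ ^ p := cubeAverage_mul_volume (fun x => ‖b x‖ ^ p) Q
  have h2 : cubeAverage (fun x => ‖b x‖ ^ p) Q ≤ |δ⁻¹ * A ^ p| := by
    refine le_trans ?_ (le_abs_self _)
    exact (lt_of_mul_lt_mul_right (h1.trans_lt h.2) Q.volumeReal_toSet_pos.le).le
  have h3 := (cubeAverage_norm_rpow_le hp hb Q).trans h2
  have h0 : 0 ≤ cubeAverage (fun x => ‖b x‖) Q := cubeAverage_nonneg (fun x => norm_nonneg _) Q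
  have hp0 : p ≠ 0 := by linarith
  calc cubeAverage (fun x => ‖b x‖) Q = (cubeAverage (fun x => ‖b x‖) Q ^ p) ^ (1 / p) := by
        rw [← Real.rpow_mul h0, mul_one_div_cancel hp0, Real.rpow_one]
    _ ≤ _ := Real.rpow_le_rpow (by positivity) h3 (by positivity)

end StoppingCubes

/-! ### Finite sums of half-twisted differences -/

section UniformBound

open DyadicCube

variable {n : ℕ} {𝕜 : Type*} [RCLike 𝕜]

lemma memLp_halfTwistedDifference (b : (Fin n → ℝ) → 𝕜) (𝒯 : Set (DyadicCube n))
    (Q : DyadicCube n) (f : (Fin n → ℝ) → 𝕜) (r : ENNReal) :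
    MemLp (halfTwistedDifference b 𝒯 Q f) r := by
  classical
  unfold halfTwistedDifference
  exact memLp_finsetSum _ fun e _ => memLp_indicator_const r (Q.child e).measurableSet_toSet _
    (Or.inr (Q.child e).volume_toSet_lt_top.ne)

lemma halfTwistedDifference_eq_zero {b : (Fin n → ℝ) → 𝕜} {𝒯 : Set (DyadicCube n)}
    {Q : DyadicCube n} {f : (Fin n → ℝ) → 𝕜} {x : Fin n → ℝ} (hx : x ∉ Q.toSet) :
    halfTwistedDifference b 𝒯 Q f x = 0 := by
  unfold halfTwistedDifference
  exact Finset.sum_eq_zero fun e _ =>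
    Set.indicator_of_notMem (fun h => hx (Q.child_subset e h)) _

lemma cubeAverage_sub {f g : (Fin n → ℝ) → 𝕜} {Q : DyadicCube n} (hf : IntegrableOn f Q.toSet)
    (hg : IntegrableOn g Q.toSet) :
    cubeAverage (fun x => f x - g x) Q = cubeAverage f Q - cubeAverage g Q := by
  simp only [cubeAverage, setAverage_eq]
  rw [integral_sub hf hg, smul_sub]

lemma halfTwistedDifference_sub {b : (Fin n → ℝ) → 𝕜} {𝒯 : Set (DyadicCube n)}
    {f g : (Fin n → ℝ) → 𝕜} (hf : ∀ Q : DyadicCube n, IntegrableOn f Q.toSet)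
    (hg : ∀ Q : DyadicCube n, IntegrableOn g Q.toSet) (Q : DyadicCube n) (x : Fin n → ℝ) :
    halfTwistedDifference b 𝒯 Q (fun x => f x - g x) x
      = halfTwistedDifference b 𝒯 Q f x - halfTwistedDifference b 𝒯 Q g x := by
  unfold halfTwistedDifference
  rw [← Finset.sum_sub_distrib]
  refine Finset.sum_congr rfl fun e _ => ?_
  rw [cubeAverage_sub (hf _) (hg _), cubeAverage_sub (hf _) (hg _)]
  by_cases hx : x ∈ (Q.child e).toSet
  · simp only [Set.indicator_of_mem hx]; ring
  · simp only [Set.indicator_of_notMem hx, sub_zero]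

open Classical in
lemma integral_halfTwistedDifference_mul (b : (Fin n → ℝ) → 𝕜) (𝒯 : Set (DyadicCube n))
    (Q : DyadicCube n) (f : (Fin n → ℝ) → 𝕜) {g : (Fin n → ℝ) → 𝕜}
    (hg : ∀ Q : DyadicCube n, IntegrableOn g Q.toSet) :
    ∫ x, halfTwistedDifference b 𝒯 Q f x * g x
      = (volume.real Q.toSet / Fintype.card (Fin n → Fin 2) : ℝ) *
        ∑ e, (if Q.child e ∉ 𝒯 then cubeAverage g (Q.child e) *
          (cubeAverage f (Q.child e) / cubeAverage b (Q.child e)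
            - cubeAverage f Q / cubeAverage b Q) else 0) := by
  set c : (Fin n → Fin 2) → 𝕜 := fun e => cubeAverage f (Q.child e) / cubeAverage b (Q.child e)
            - cubeAverage f Q / cubeAverage b Q with hc
  have h1 : ∀ x, halfTwistedDifference b 𝒯 Q f x * g x
      = ∑ e ∈ Finset.univ.filter (fun e : Fin n → Fin 2 => Q.child e ∉ 𝒯),
        (Q.child e).toSet.indicator (fun x => c e * g x) x := by
    intro x
    unfold halfTwistedDifference
    rw [Finset.sum_mul]
    refine Finset.sum_congr rfl fun e _ => ?_
    by_cases hx : x ∈ (Q.child e).toSet <;> simp [hx, hc]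
  simp only [h1]
  rw [integral_finsetSum _ fun e _ =>
    (integrable_indicator_iff (Q.child e).measurableSet_toSet).2 ((hg (Q.child e)).const_mul (c e)),
    ← Finset.sum_filter, Finset.mul_sum]
  refine Finset.sum_congr rfl fun e _ => ?_
  rw [integral_indicator (Q.child e).measurableSet_toSet, integral_const_mul,
    ← cubeAverage_mul_volume, ← volumeReal_child Q e,
    mul_div_cancel_left₀ _ (card_pos_real (ι := Fin n → Fin 2)).ne']
  ring

/-- The bilinear form of the half-twisted differences converges absolutely. The bound is not
homogeneous. Scaling `g` makes it so. -/
lemma exists_sum_norm_integral_le (hn : 1 ≤ n) {p q s : ℝ} (hp : 1 < p)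
    (hqs : q.HolderConjugate s) (A : ℝ) {δ : ℝ} (hδ : 0 < δ) :
    ∃ C : ℝ, 0 < C ∧ ∀ (S₀ : DyadicCube n) (b : (Fin n → ℝ) → 𝕜),
      MemLp b (ENNReal.ofReal p) → ∀ 𝒯 : Set (DyadicCube n), IsTerminalFamily S₀ b p A δ 𝒯 →
      ∀ F : Finset (DyadicCube n), (∀ Q ∈ F, Q ∈ nonterminalCubes S₀ 𝒯) →
      ∀ f g : (Fin n → ℝ) → 𝕜, MemLp f (ENNReal.ofReal q) → MemLp g (ENNReal.ofReal s) →
      ∑ Q ∈ F, ‖∫ x, halfTwistedDifference b 𝒯 Q f x * g x‖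
        ≤ C * ((∫ x, ‖f x‖ ^ q) + ∫ x, ‖g x‖ ^ s) := by
  classical
  set N : ℝ := (Fintype.card (Fin n → Fin 2) : ℝ) with hN
  have hN0 : 0 < N := card_pos_real
  have hN1 : 1 ≤ N := one_le_card_real
  set B₀ : ℝ := |δ⁻¹ * A ^ p| ^ (1 / p) with hB₀
  have hB₀0 : 0 ≤ B₀ := by positivity
  have hB0 : 0 ≤ N * B₀ := by positivity
  obtain ⟨C₁, hC₁, h₁⟩ := norm_sum_halfTwisted_le (ι := Fin n → Fin 2) (𝕜 := 𝕜) hδ hB0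
  obtain ⟨C₂, hC₂, h₂⟩ := sum_treeMean_interactionKernel_le (ι := Fin n → Fin 2) (𝕜 := 𝕜) hqs
    (B := N * B₀)
  refine ⟨C₁ * C₂, by positivity, ?_⟩
  intro S₀ b hb 𝒯 h𝒯 F hF f g hf hg
  have hq := hqs.lt
  have hs := hqs.symm.lt
  have hfi : 0 ≤ ∫ x, ‖f x‖ ^ q := integral_nonneg fun x => by positivity
  have hgi : 0 ≤ ∫ x, ‖g x‖ ^ s := integral_nonneg fun x => by positivity
  set 𝒬 : Set (List (Fin n → Fin 2)) := {l | S₀.descendant l ∈ nonterminalCubes S₀ 𝒯} with h𝒬def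
  have h𝒬 : ∀ e l, e :: l ∈ 𝒬 → l ∈ 𝒬 := fun e l h =>
    mem_nonterminalCubes_of_child (S₀.descendant_subset l) h
  rcases F.eq_empty_or_nonempty with rfl | ⟨Q₀, hQ₀⟩
  · simp only [Finset.sum_empty]; positivity
  have hroot : [] ∈ 𝒬 := by
    obtain ⟨l, hl⟩ := exists_descendant_eq hn (hF Q₀ hQ₀).1
    have hl' : l ∈ 𝒬 := by rw [h𝒬def, Set.mem_ofPred_eq, hl]; exact hF Q₀ hQ₀
    clear hl
    induction l with
    | nil => exact hl'
    | cons e l ih => exact ih (h𝒬 e l hl')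
  set f' := fun l => cubeAverage f (S₀.descendant l) with hf'
  set g' := fun l => cubeAverage g (S₀.descendant l) with hg'
  set b' := fun l => cubeAverage b (S₀.descendant l) with hb'
  set F' := fun l => cubeAverage (fun x => ‖f x‖) (S₀.descendant l) with hF'
  set G' := fun l => cubeAverage (fun x => ‖g x‖) (S₀.descendant l) with hG'
  have mf : IsTreeMartingale f' := isTreeMartingale_cubeAverage S₀ (hf.integrableOn_cube hq)
  have mg : IsTreeMartingale g' := isTreeMartingale_cubeAverage S₀ (hg.integrableOn_cube hs)
  have mb : IsTreeMartingale b' := isTreeMartingale_cubeAverage S₀ (hb.integrableOn_cube hp)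
  have mF : IsTreeMartingale F' :=
    isTreeMartingale_cubeAverage S₀ fun Q => (hf.integrableOn_cube hq Q).norm
  have mG : IsTreeMartingale G' :=
    isTreeMartingale_cubeAverage S₀ fun Q => (hg.integrableOn_cube hs Q).norm
  have mB : IsTreeMartingale fun l => cubeAverage (fun x => ‖b x‖) (S₀.descendant l) :=
    isTreeMartingale_cubeAverage S₀ fun Q => (hb.integrableOn_cube hp Q).norm
  have hfF : ∀ l, ‖f' l‖ ≤ F' l := fun l => norm_cubeAverage_le _ _
  have hgG : ∀ l, ‖g' l‖ ≤ G' l := fun l => norm_cubeAverage_le _ _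
  have hB0' : ∀ l ∈ 𝒬, cubeAverage (fun x => ‖b x‖) (S₀.descendant l) ≤ B₀ := fun l hl =>
    cubeAverage_norm_le_of_mem hn hp hb h𝒯 hl
  have hbroot : ‖b' []‖ ≤ N * B₀ :=
    ((norm_cubeAverage_le _ _).trans (hB0' [] hroot)).trans (le_mul_of_one_le_left hB₀0 hN1)
  have hbB : ∀ l ∈ 𝒬, ∀ e, ‖b' (e :: l)‖ ≤ N * B₀ := fun l hl e => by
    refine (norm_cubeAverage_le _ _).trans ?_
    refine (mB.le_card_mul (fun l => cubeAverage_nonneg (fun x => norm_nonneg _) _) e l).trans ?_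
    have := hB0' l hl
    gcongr
  have hδb : ∀ l ∈ 𝒬, δ ≤ ‖b' l‖ := fun l hl => le_norm_cubeAverage_of_mem hn h𝒯 hl
  obtain ⟨K, hK⟩ := exists_sum_volume_le hn S₀ F fun Q hQ => (hF Q hQ).1
  have hker := hK (fun l => C₁ * interactionKernel 𝒬 f' g' (stoppedProcessOn 𝒬 b') F' G' l)
    (fun l => mul_nonneg hC₁.le (interactionKernel_nonneg
      (fun l => (norm_nonneg _).trans (hfF l)) (fun l => (norm_nonneg _).trans (hgG l)) l))
    (fun Q => ‖∫ x, halfTwistedDifference b 𝒯 Q f x * g x‖ / volume.real Q.toSet) (by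
      intro l hl
      have hl' : l ∈ 𝒬 := hF _ hl
      refine le_trans (le_of_eq ?_)
        (h₁ 𝒬 h𝒬 f' g' b' F' G' mf mb mF mG hfF hgG hδb hbroot hbB l hl')
      rw [integral_halfTwistedDifference_mul b 𝒯 _ f (hg.integrableOn_cube hs), norm_mul,
        RCLike.norm_ofReal, abs_of_nonneg (by positivity)]
      have hv := (S₀.descendant l).volumeReal_toSet_pos
      have hiff : ∀ e, (S₀.descendant l).child e ∉ 𝒯 ↔ e :: l ∈ 𝒬 := fun e =>
        (child_mem_nonterminalCubes_iff hn hl' e).symm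
      simp only [hiff]
      rw [div_mul_eq_mul_div, div_right_comm, mul_div_cancel_left₀ _ hv.ne']
      rfl)
  have hT := h₂ 𝒬 h𝒬 f' g' (stoppedProcessOn 𝒬 b') F' G' mf mg (mb.stoppedProcessOn h𝒬) mF mG
    hfF hgG (norm_stoppedProcessOn_le hbroot hbB) K
  have e1 := treeMean_cubeAverage_norm_rpow_le S₀ hq hf K
  have e2 := treeMean_cubeAverage_norm_rpow_le S₀ hs hg K
  have hv := S₀.volumeReal_toSet_pos
  calc ∑ Q ∈ F, ‖∫ x, halfTwistedDifference b 𝒯 Q f x * g x‖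
      = ∑ Q ∈ F, volume.real Q.toSet *
          (‖∫ x, halfTwistedDifference b 𝒯 Q f x * g x‖ / volume.real Q.toSet) :=
        Finset.sum_congr rfl fun Q _ => by
          rw [mul_div_cancel₀ _ Q.volumeReal_toSet_pos.ne']
    _ ≤ _ := hker
    _ = C₁ * (volume.real S₀.toSet * ∑ k ∈ Finset.range K,
          treeMean k (interactionKernel 𝒬 f' g' (stoppedProcessOn 𝒬 b') F' G')) := by
        simp only [treeMean_const_mul, ← Finset.mul_sum]; ring
    _ ≤ C₁ * (volume.real S₀.toSet * (C₂ * (treeMean K (fun l => F' l ^ q)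
          + treeMean K (fun l => G' l ^ s)))) := by gcongr
    _ = C₁ * C₂ * (volume.real S₀.toSet * treeMean K (fun l => F' l ^ q)
          + volume.real S₀.toSet * treeMean K (fun l => G' l ^ s)) := by ring
    _ ≤ _ := by gcongr

/-- Duality with a non-homogeneous bound: the test function is a small multiple of
`conj h * |h| ^ (q - 2)`. -/
lemma eLpNorm_le_of_forall_norm_integral_le {α : Type*} [MeasurableSpace α] {μ : Measure α}
    {q s : ℝ} (hqs : q.HolderConjugate s) {C : ℝ} (hC : 0 < C) :
    ∃ C' : ℝ, 0 < C' ∧ ∀ f h : α → 𝕜, MemLp f (ENNReal.ofReal q) μ →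
      MemLp h (ENNReal.ofReal q) μ →
      (∀ g : α → 𝕜, MemLp g (ENNReal.ofReal s) μ →
        ‖∫ x, h x * g x ∂μ‖ ≤ C * ((∫ x, ‖f x‖ ^ q ∂μ) + ∫ x, ‖g x‖ ^ s ∂μ)) →
      eLpNorm h (ENNReal.ofReal q) μ ≤ ENNReal.ofReal C' * eLpNorm f (ENNReal.ofReal q) μ := by
  have hq := hqs.lt
  have hs := hqs.symm.lt
  have hq0 : 0 < q := by linarith
  have hs0 : 0 < s := by linarith
  have hqt : (ENNReal.ofReal q).toReal = q := ENNReal.toReal_ofReal hq0.le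
  have hst : (ENNReal.ofReal s).toReal = s := ENNReal.toReal_ofReal hs0.le
  have hqs' : (q - 1) * s = q := by have := hqs.mul_eq_add; linarith
  -- `t` is chosen so that `C * t ^ s = t / 2`.
  obtain ⟨t, ht⟩ : ∃ t : ℝ, t = (2 * C)⁻¹ ^ (1 / (s - 1)) := ⟨_, rfl⟩
  have ht0 : 0 < t := by rw [ht]; positivity
  have hts : C * t ^ s = t / 2 := by
    have h1 : t ^ (s - 1) = (2 * C)⁻¹ := by
      rw [ht, ← Real.rpow_mul (by positivity), one_div_mul_cancel (by linarith), Real.rpow_one]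
    have h2 : t ^ s = t ^ (s - 1) * t := by
      rw [← Real.rpow_add_one ht0.ne']; ring_nf
    rw [h2, h1]; field_simp
  refine ⟨(2 * C / t) ^ q⁻¹, by positivity, fun f h hf hh hbound => ?_⟩
  set g : α → 𝕜 := fun x => (t : 𝕜) * (starRingEnd 𝕜 (h x) * ((‖h x‖ ^ (q - 2) : ℝ) : 𝕜)) with hg
  have hgn : ∀ x, ‖g x‖ ^ s = t ^ s * ‖h x‖ ^ q := by
    intro x
    have h1 : ‖g x‖ = t * ‖h x‖ ^ (q - 1) := by
      simp only [hg, norm_mul, RCLike.norm_ofReal, RCLike.norm_conj, abs_of_pos ht0]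
      rw [abs_of_nonneg (by positivity), ← Real.rpow_one_add' (norm_nonneg _) (by linarith)]
      ring_nf
    rw [h1, Real.mul_rpow ht0.le (by positivity), ← Real.rpow_mul (norm_nonneg _), hqs']
  have hhi : Integrable (fun x => ‖h x‖ ^ q) μ := hh.integrable_norm_rpow_of_pos hq0
  have hgm : AEStronglyMeasurable g μ := by
    refine AEStronglyMeasurable.const_mul ?_ _
    refine AEStronglyMeasurable.mul ?_ ?_
    · exact RCLike.continuous_conj.comp_aestronglyMeasurable hh.1
    · exact RCLike.continuous_ofReal.comp_aestronglyMeasurable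
        (hh.1.norm.aemeasurable.pow_const _).aestronglyMeasurable
  have hgL : MemLp g (ENNReal.ofReal s) μ := by
    rw [← integrable_norm_rpow_iff hgm (by simpa using hs0) ENNReal.ofReal_ne_top, hst]
    simp only [hgn]
    exact hhi.const_mul _
  have hprod : ∀ x, h x * g x = ((t * ‖h x‖ ^ q : ℝ) : 𝕜) := by
    intro x
    have h1 : ‖h x‖ ^ q = ‖h x‖ ^ 2 * ‖h x‖ ^ (q - 2) := by
      rw [← Real.rpow_natCast, ← Real.rpow_add' (norm_nonneg _) (by norm_num; linarith)]
      norm_num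
    calc h x * g x = t * (h x * starRingEnd 𝕜 (h x)) * ((‖h x‖ ^ (q - 2) : ℝ) : 𝕜) := by
          simp only [hg]; ring
      _ = _ := by rw [RCLike.mul_conj, h1]; push_cast; ring
  have key := hbound g hgL
  simp only [hprod, hgn] at key
  rw [integral_ofReal, integral_const_mul, integral_const_mul, RCLike.norm_ofReal] at key
  have hJ : 0 ≤ ∫ x, ‖h x‖ ^ q ∂μ := integral_nonneg fun x => by positivity
  have hI : 0 ≤ ∫ x, ‖f x‖ ^ q ∂μ := integral_nonneg fun x => by positivity
  rw [abs_of_nonneg (by positivity), mul_add, ← mul_assoc, hts] at key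
  have hfin : ∫ x, ‖h x‖ ^ q ∂μ ≤ 2 * C / t * ∫ x, ‖f x‖ ^ q ∂μ := by
    rw [div_mul_eq_mul_div, le_div_iff₀ ht0]; linarith
  rw [hh.eLpNorm_eq_integral_rpow_norm (by simpa using hq0) ENNReal.ofReal_ne_top,
    hf.eLpNorm_eq_integral_rpow_norm (by simpa using hq0) ENNReal.ofReal_ne_top, hqt,
    ← ENNReal.ofReal_mul (by positivity), ← Real.mul_rpow (by positivity) hI]
  exact ENNReal.ofReal_le_ofReal (Real.rpow_le_rpow hJ hfin (by positivity))

/-- The `L^q` inequality for finite sums, for all multipliers at once. -/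
lemma exists_eLpNorm_sum_halfTwistedDifference_le (hn : 1 ≤ n) {p q : ℝ} (hp : 1 < p)
    (hq : 1 < q) (A : ℝ) {δ : ℝ} (hδ : 0 < δ) :
    ∃ C : ℝ, 0 < C ∧ ∀ (S₀ : DyadicCube n) (b : (Fin n → ℝ) → 𝕜),
      MemLp b (ENNReal.ofReal p) → ∀ 𝒯 : Set (DyadicCube n), IsTerminalFamily S₀ b p A δ 𝒯 →
      ∀ (F : Finset (nonterminalCubes S₀ 𝒯)) (ε : DyadicCube n → 𝕜),
      (∀ Q ∈ nonterminalCubes S₀ 𝒯, ‖ε Q‖ ≤ 1) →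
      ∀ f : (Fin n → ℝ) → 𝕜, MemLp f (ENNReal.ofReal q) →
      eLpNorm (fun x => ∑ Q ∈ F, ε Q * halfTwistedDifference b 𝒯 Q f x) (ENNReal.ofReal q) volume
        ≤ ENNReal.ofReal C * eLpNorm f (ENNReal.ofReal q) volume := by
  classical
  have hqs : q.HolderConjugate (q / (q - 1)) := Real.HolderConjugate.conjExponent hq
  set s := q / (q - 1) with hs
  obtain ⟨C, hC, hbil⟩ := exists_sum_norm_integral_le (𝕜 := 𝕜) hn hp hqs A hδ
  obtain ⟨C', hC', hdual⟩ := eLpNorm_le_of_forall_norm_integral_le (𝕜 := 𝕜)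
    (μ := (volume : Measure (Fin n → ℝ))) hqs hC
  refine ⟨C', hC', fun S₀ b hb 𝒯 h𝒯 F ε hε f hf => ?_⟩
  refine hdual f _ hf (memLp_finsetSum _ fun Q _ =>
    (memLp_halfTwistedDifference b 𝒯 Q f _).const_mul _) fun g hg => ?_
  have := hqs.ennrealOfReal
  have hint : ∀ Q : DyadicCube n,
      Integrable (fun x => halfTwistedDifference b 𝒯 Q f x * g x) := fun Q =>
    MemLp.integrable_mul (memLp_halfTwistedDifference b 𝒯 Q f (ENNReal.ofReal q)) hg
  have h1 : ∫ x, (∑ Q ∈ F, ε Q * halfTwistedDifference b 𝒯 Q f x) * g x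
      = ∑ Q ∈ F, ε Q * ∫ x, halfTwistedDifference b 𝒯 Q f x * g x := by
    simp only [Finset.sum_mul, mul_assoc]
    rw [integral_finsetSum F fun (Q : nonterminalCubes S₀ 𝒯) _ => (hint Q).const_mul (ε Q)]
    simp only [integral_const_mul]
  rw [h1]
  calc _ ≤ ∑ Q ∈ F, ‖∫ x, halfTwistedDifference b 𝒯 Q f x * g x‖ := by
        refine norm_sum_le_of_le _ fun Q _ => ?_
        rw [norm_mul]
        exact mul_le_of_le_one_left (norm_nonneg _) (hε Q Q.2)
    _ = ∑ Q ∈ F.map (Function.Embedding.subtype _),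
          ‖∫ x, halfTwistedDifference b 𝒯 Q f x * g x‖ := by simp
    _ ≤ _ := hbil S₀ b hb 𝒯 h𝒯 _ (fun Q hQ => by
        obtain ⟨Q', -, rfl⟩ := Finset.mem_map.1 hQ
        exact Q'.2) f g hf hg

end UniformBound

/-! ### Unconditional convergence -/

section UnconditionalConvergence

variable {𝕜 : Type*} [RCLike 𝕜]

/-- Clarkson's inequality for exponents at least `2`. -/
lemma two_mul_norm_rpow_add_le {q : ℝ} (hq : 2 ≤ q) (v u : 𝕜) :
    2 * (‖v‖ ^ q + ‖u‖ ^ q) ≤ ‖v + u‖ ^ q + ‖v - u‖ ^ q := by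
  have ht : 1 ≤ q / 2 := by linarith
  have hsq : ∀ w : 𝕜, ‖w‖ ^ q = (‖w‖ ^ 2) ^ (q / 2) := fun w => by
    rw [← Real.rpow_natCast, ← Real.rpow_mul (norm_nonneg _)]; congr 1; push_cast; ring
  have h1 := (convexOn_rpow ht).2 (Set.mem_Ici.2 (sq_nonneg ‖v + u‖))
    (Set.mem_Ici.2 (sq_nonneg ‖v - u‖)) (show (0 : ℝ) ≤ 1 / 2 by norm_num)
    (show (0 : ℝ) ≤ 1 / 2 by norm_num) (by norm_num)
  simp only [smul_eq_mul] at h1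
  have h2 : 1 / 2 * ‖v + u‖ ^ 2 + 1 / 2 * ‖v - u‖ ^ 2 = ‖v‖ ^ 2 + ‖u‖ ^ 2 := by
    have := parallelogram_law_with_norm 𝕜 v u
    linarith
  have h3 := Real.add_rpow_le_rpow_add (sq_nonneg ‖v‖) (sq_nonneg ‖u‖) ht
  rw [h2] at h1
  rw [hsq, hsq, hsq, hsq]
  linarith

variable {α : Type*} [MeasurableSpace α] {μ : Measure α}

lemma eLpNorm_ofReal_eq {h : α → 𝕜} {q : ℝ} (hq : 0 < q) (hh : MemLp h (ENNReal.ofReal q) μ) :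
    eLpNorm h (ENNReal.ofReal q) μ = ENNReal.ofReal ((∫ x, ‖h x‖ ^ q ∂μ) ^ q⁻¹) := by
  rw [hh.eLpNorm_eq_integral_rpow_norm (by simpa using hq) ENNReal.ofReal_ne_top,
    ENNReal.toReal_ofReal hq.le]

/-- With a good choice of the sign, `q`-th powers of `L^q` norms are superadditive. -/
lemma exists_sign_integral_rpow_le {q : ℝ} (hq : 2 ≤ q) {v u : α → 𝕜}
    (hv : MemLp v (ENNReal.ofReal q) μ) (hu : MemLp u (ENNReal.ofReal q) μ) :
    ∃ σ : 𝕜, ‖σ‖ ≤ 1 ∧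
      (∫ x, ‖v x‖ ^ q ∂μ) + ∫ x, ‖u x‖ ^ q ∂μ ≤ ∫ x, ‖v x + σ * u x‖ ^ q ∂μ := by
  have hq0 : 0 < q := by linarith
  have iv := hv.integrable_norm_rpow_of_pos hq0
  have iu := hu.integrable_norm_rpow_of_pos hq0
  have ia : Integrable (fun x => ‖v x + u x‖ ^ q) μ := (hv.add hu).integrable_norm_rpow_of_pos hq0
  have is : Integrable (fun x => ‖v x - u x‖ ^ q) μ := (hv.sub hu).integrable_norm_rpow_of_pos hq0
  have h : 2 * ((∫ x, ‖v x‖ ^ q ∂μ) + ∫ x, ‖u x‖ ^ q ∂μ)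
      ≤ (∫ x, ‖v x + u x‖ ^ q ∂μ) + ∫ x, ‖v x - u x‖ ^ q ∂μ := by
    rw [← integral_add iv iu, ← integral_add ia is, ← integral_const_mul]
    exact integral_mono ((iv.add iu).const_mul 2) (ia.add is)
      fun x => two_mul_norm_rpow_add_le hq (v x) (u x)
  rcases le_total ((∫ x, ‖v x‖ ^ q ∂μ) + ∫ x, ‖u x‖ ^ q ∂μ) (∫ x, ‖v x + u x‖ ^ q ∂μ) with h' | h'
  · exact ⟨1, by simp, by simpa using h'⟩
  · refine ⟨-1, by simp, ?_⟩
    simp only [neg_one_mul, ← sub_eq_add_neg]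
    linarith

variable {κ : Type*}

/-- For `q ≥ 2`, a series in `L^q` whose signed finite sums are bounded has small tails: otherwise
infinitely many disjoint blocks of size at least `η` could be added up with good signs. -/
lemma exists_tail_le_of_two_le {q : ℝ} (hq : 2 ≤ q) {x : κ → α → 𝕜}
    (hx : ∀ i, MemLp (x i) (ENNReal.ofReal q) μ) {R : ENNReal} (hR : R ≠ ⊤)
    (hbound : ∀ (F : Finset κ) (σ : κ → 𝕜), (∀ i, ‖σ i‖ ≤ 1) →
      eLpNorm (fun a => ∑ i ∈ F, σ i * x i a) (ENNReal.ofReal q) μ ≤ R) {η : ℝ} (hη : 0 < η) :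
    ∃ s : Finset κ, ∀ t : Finset κ, Disjoint t s →
      eLpNorm (fun a => ∑ i ∈ t, x i a) (ENNReal.ofReal q) μ ≤ ENNReal.ofReal η := by
  classical
  have hq0 : 0 < q := by linarith
  by_contra! hcon
  have hmem : ∀ (F : Finset κ) (σ : κ → 𝕜),
      MemLp (fun a => ∑ i ∈ F, σ i * x i a) (ENNReal.ofReal q) μ := fun F σ =>
    memLp_finsetSum F fun i _ => (hx i).const_mul (σ i)
  have hmem' : ∀ F : Finset κ, MemLp (fun a => ∑ i ∈ F, x i a) (ENNReal.ofReal q) μ := fun F =>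
    memLp_finsetSum F fun i _ => hx i
  have hblocks : ∀ N : ℕ, ∃ (F : Finset κ) (σ : κ → 𝕜), (∀ i, ‖σ i‖ ≤ 1) ∧
      N * η ^ q ≤ ∫ a, ‖∑ i ∈ F, σ i * x i a‖ ^ q ∂μ := by
    intro N
    induction N with
    | zero => exact ⟨∅, fun _ => 0, by simp, by simp [Real.zero_rpow hq0.ne']⟩
    | succ N ih =>
      obtain ⟨F, σ, hσ, hF⟩ := ih
      obtain ⟨t, htF, ht⟩ := hcon F
      have ht' : η ^ q ≤ ∫ a, ‖∑ i ∈ t, x i a‖ ^ q ∂μ := by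
        have h0 : 0 ≤ ∫ a, ‖∑ i ∈ t, x i a‖ ^ q ∂μ := integral_nonneg fun a => by positivity
        rw [eLpNorm_ofReal_eq hq0 (hmem' t), ENNReal.ofReal_lt_ofReal_iff_of_nonneg hη.le] at ht
        have := Real.rpow_le_rpow hη.le ht.le hq0.le
        rwa [← Real.rpow_mul h0, inv_mul_cancel₀ hq0.ne', Real.rpow_one] at this
      obtain ⟨τ, hτ, hle⟩ := exists_sign_integral_rpow_le hq (hmem F σ) (hmem' t)
      refine ⟨F ∪ t, fun i => if i ∈ t then τ else σ i, fun i => ?_, ?_⟩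
      · dsimp only
        split_ifs
        exacts [hτ, hσ i]
      · have hsum : ∀ a, ∑ i ∈ F ∪ t, (if i ∈ t then τ else σ i) * x i a
            = ∑ i ∈ F, σ i * x i a + τ * ∑ i ∈ t, x i a := by
          intro a
          rw [Finset.sum_union htF.symm, Finset.mul_sum]
          congr 1
          · refine Finset.sum_congr rfl fun i hi => ?_
            rw [if_neg (Finset.disjoint_right.1 htF hi)]
          · exact Finset.sum_congr rfl fun i hi => by rw [if_pos hi]
        simp only [hsum]
        push_cast
        linarith
  obtain ⟨N, hN⟩ := exists_nat_gt (R.toReal ^ q / η ^ q)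
  obtain ⟨F, σ, hσ, hF⟩ := hblocks N
  have h0 : 0 ≤ ∫ a, ‖∑ i ∈ F, σ i * x i a‖ ^ q ∂μ := integral_nonneg fun a => by positivity
  have h1 := hbound F σ hσ
  rw [eLpNorm_ofReal_eq hq0 (hmem F σ), ENNReal.ofReal_le_iff_le_toReal hR] at h1
  have h2 := Real.rpow_le_rpow (by positivity) h1 hq0.le
  rw [← Real.rpow_mul h0, inv_mul_cancel₀ hq0.ne', Real.rpow_one] at h2
  rw [div_lt_iff₀ (by positivity)] at hN
  linarith

/-- A series with small tails and bounded finite sums converges unconditionally. -/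
lemma exists_tendsto_eLpNorm_sum_sub {q : ℝ} (hq : 1 ≤ q) {x : κ → α → 𝕜}
    (hx : ∀ i, MemLp (x i) (ENNReal.ofReal q) μ) {R : ENNReal}
    (hbound : ∀ F : Finset κ, eLpNorm (fun a => ∑ i ∈ F, x i a) (ENNReal.ofReal q) μ ≤ R)
    (htail : ∀ η : ℝ, 0 < η → ∃ s : Finset κ, ∀ t : Finset κ, Disjoint t s →
      eLpNorm (fun a => ∑ i ∈ t, x i a) (ENNReal.ofReal q) μ ≤ ENNReal.ofReal η) :
    ∃ g : α → 𝕜, MemLp g (ENNReal.ofReal q) μ ∧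
      Tendsto (fun F : Finset κ =>
        eLpNorm (fun a => (∑ i ∈ F, x i a) - g a) (ENNReal.ofReal q) μ) atTop (𝓝 0) ∧
      eLpNorm g (ENNReal.ofReal q) μ ≤ R := by
  classical
  have : Fact (1 ≤ ENNReal.ofReal q) := ⟨by simpa using hq⟩
  have hmem : ∀ F : Finset κ, MemLp (fun a => ∑ i ∈ F, x i a) (ENNReal.ofReal q) μ := fun F =>
    memLp_finsetSum F fun i _ => hx i
  have hsum : ∀ F : Finset κ, ∑ i ∈ F, (hx i).toLp (x i) = (hmem F).toLp _ := by
    intro F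
    induction F using Finset.induction_on with
    | empty =>
      rw [Finset.sum_empty, ← MemLp.toLp_zero (MemLp.zero')]
      exact MemLp.toLp_congr _ _ (ae_of_all _ fun a => by simp)
    | insert i F hi ih =>
      rw [Finset.sum_insert hi, ih, ← MemLp.toLp_add]
      exact MemLp.toLp_congr _ _ (ae_of_all _ fun a => by simp [Finset.sum_insert hi])
  have hS : Summable fun i => (hx i).toLp (x i) := by
    rw [summable_iff_vanishing_norm]
    intro η hη
    obtain ⟨s, hs⟩ := htail (η / 2) (by linarith)
    refine ⟨s, fun t ht => ?_⟩
    rw [hsum, Lp.norm_toLp]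
    exact (ENNReal.toReal_le_of_le_ofReal (by linarith) (hs t ht)).trans_lt (by linarith)
  set g := ∑' i, (hx i).toLp (x i) with hg
  have htend : Tendsto (fun F : Finset κ =>
      eLpNorm (fun a => (∑ i ∈ F, x i a) - g a) (ENNReal.ofReal q) μ) atTop (𝓝 0) := by
    have h1 : Tendsto (fun F : Finset κ => (hmem F).toLp _) atTop
        (𝓝 ((Lp.memLp g).toLp g)) := by
      rw [Lp.toLp_coeFn]
      have h2 : Tendsto (fun F : Finset κ => ∑ i ∈ F, (hx i).toLp (x i)) atTop (𝓝 g) := hS.hasSum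
      exact h2.congr hsum
    exact (Lp.tendsto_Lp_iff_tendsto_eLpNorm'' _ hmem g (Lp.memLp g)).1 h1
  refine ⟨g, Lp.memLp g, htend, ?_⟩
  have h3 : ∀ F : Finset κ, eLpNorm g (ENNReal.ofReal q) μ
      ≤ eLpNorm (fun a => (∑ i ∈ F, x i a) - g a) (ENNReal.ofReal q) μ + R := by
    intro F
    have h4 : (g : α → 𝕜) = (fun a => ∑ i ∈ F, x i a) - fun a => (∑ i ∈ F, x i a) - g a := by
      funext a; simp
    calc eLpNorm g (ENNReal.ofReal q) μ
        = eLpNorm ((fun a => ∑ i ∈ F, x i a) - fun a => (∑ i ∈ F, x i a) - g a)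
            (ENNReal.ofReal q) μ := by rw [← h4]
      _ ≤ _ := eLpNorm_sub_le (hmem F).1 ((hmem F).sub (Lp.memLp g)).1 Fact.out
      _ ≤ _ := by rw [add_comm]; gcongr; exact hbound F
  have h5 := htend.add_const R
  rw [zero_add] at h5
  exact ge_of_tendsto' h5 h3

end UnconditionalConvergence

section Convergence

open DyadicCube

variable {n : ℕ} {𝕜 : Type*} [RCLike 𝕜]

/-- The tails of the series of half-twisted differences are small in `L^q`. For `q < 2` the
function is approximated by simple functions, for which the tails are small in `L^2`, hence in
`L^q` as everything is supported in `S₀`. -/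
lemma exists_tail_halfTwistedDifference_le (hn : 1 ≤ n) {p q : ℝ} (hp : 1 < p)
    (hq : 1 < q) {A δ : ℝ} (hδ : 0 < δ) {S₀ : DyadicCube n} {b : (Fin n → ℝ) → 𝕜}
    (hb : MemLp b (ENNReal.ofReal p)) {𝒯 : Set (DyadicCube n)}
    (h𝒯 : IsTerminalFamily S₀ b p A δ 𝒯) {ε : DyadicCube n → 𝕜}
    (hε : ∀ Q ∈ nonterminalCubes S₀ 𝒯, ‖ε Q‖ ≤ 1) {f : (Fin n → ℝ) → 𝕜}
    (hf : MemLp f (ENNReal.ofReal q)) {η : ℝ} (hη : 0 < η) :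
    ∃ s : Finset (nonterminalCubes S₀ 𝒯), ∀ t : Finset (nonterminalCubes S₀ 𝒯), Disjoint t s →
      eLpNorm (fun x => ∑ Q ∈ t, ε Q * halfTwistedDifference b 𝒯 Q f x) (ENNReal.ofReal q) volume
        ≤ ENNReal.ofReal η := by
  have hlarge : ∀ r : ℝ, 2 ≤ r → ∀ f : (Fin n → ℝ) → 𝕜, MemLp f (ENNReal.ofReal r) → ∀ η : ℝ,
      0 < η → ∃ s : Finset (nonterminalCubes S₀ 𝒯), ∀ t : Finset (nonterminalCubes S₀ 𝒯),
      Disjoint t s →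
      eLpNorm (fun x => ∑ Q ∈ t, ε Q * halfTwistedDifference b 𝒯 Q f x) (ENNReal.ofReal r) volume
        ≤ ENNReal.ofReal η := by
    classical
    intro r hr f hf η hη
    obtain ⟨C, hC, h⟩ := exists_eLpNorm_sum_halfTwistedDifference_le (𝕜 := 𝕜) hn hp
      (show 1 < r by linarith) A hδ
    refine exists_tail_le_of_two_le hr (fun Q : nonterminalCubes S₀ 𝒯 =>
      (memLp_halfTwistedDifference b 𝒯 Q f _).const_mul (ε Q))
      (R := ENNReal.ofReal C * eLpNorm f (ENNReal.ofReal r) volume)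
      (ENNReal.mul_ne_top ENNReal.ofReal_ne_top hf.2.ne) (fun F σ hσ => ?_) hη
    have := h S₀ b hb 𝒯 h𝒯 F
      (fun Q => if hQ : Q ∈ nonterminalCubes S₀ 𝒯 then σ ⟨Q, hQ⟩ * ε Q else 0)
      (fun Q hQ => by
        rw [dif_pos hQ, norm_mul]
        exact mul_le_one₀ (hσ _) (norm_nonneg _) (hε Q hQ)) f hf
    simpa [mul_assoc] using this
  rcases le_total 2 q with hq2 | hq2
  · exact hlarge q hq2 f hf η hη
  obtain ⟨C, hC, hbd⟩ := exists_eLpNorm_sum_halfTwistedDifference_le (𝕜 := 𝕜) hn hp hq A hδ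
  have hq0 : 0 < q := by linarith
  obtain ⟨φ, hφ, hφq⟩ := hf.exists_simpleFunc_eLpNorm_sub_lt ENNReal.ofReal_ne_top
    (ε := ENNReal.ofReal (η / (2 * C))) 
    (by simp only [ne_eq, ENNReal.ofReal_eq_zero, not_le]; positivity)
  have hφ2 : MemLp φ (ENNReal.ofReal 2) (volume : Measure (Fin n → ℝ)) :=
    φ.memLp_of_finite_measure_preimage _
      ((SimpleFunc.memLp_iff (by simpa using hq0) ENNReal.ofReal_ne_top).1 hφq)
  obtain ⟨c, hc⟩ : ∃ c : ℝ, c = (volume.real S₀.toSet) ^ (1 / q - 1 / 2) := ⟨_, rfl⟩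
  have hv := S₀.volumeReal_toSet_pos
  have hc0 : 0 < c := by rw [hc]; positivity
  obtain ⟨s, hs⟩ := hlarge 2 le_rfl φ hφ2 (η / (2 * c)) (by positivity)
  refine ⟨s, fun t ht => ?_⟩
  have hDm : ∀ (f : (Fin n → ℝ) → 𝕜) (r : ENNReal),
      MemLp (fun x => ∑ Q ∈ t, ε Q * halfTwistedDifference b 𝒯 Q f x) r := fun f r =>
    memLp_finsetSum t fun Q _ => (memLp_halfTwistedDifference b 𝒯 Q f r).const_mul (ε Q)
  have hsub : (fun x => ∑ Q ∈ t, ε Q * halfTwistedDifference b 𝒯 Q f x)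
      = (fun x => ∑ Q ∈ t, ε Q * halfTwistedDifference b 𝒯 Q (fun y => f y - φ y) x)
        + fun x => ∑ Q ∈ t, ε Q * halfTwistedDifference b 𝒯 Q φ x := by
    funext x
    rw [Pi.add_apply, ← Finset.sum_add_distrib]
    refine Finset.sum_congr rfl fun Q _ => ?_
    rw [halfTwistedDifference_sub (hf.integrableOn_cube hq) (hφq.integrableOn_cube hq)]
    ring
  have h1 : eLpNorm (fun x => ∑ Q ∈ t, ε Q * halfTwistedDifference b 𝒯 Q (fun y => f y - φ y) x)
      (ENNReal.ofReal q) volume ≤ ENNReal.ofReal (η / 2) := by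
    refine (hbd S₀ b hb 𝒯 h𝒯 t ε hε _ (hf.sub hφq)).trans ?_
    calc _ ≤ ENNReal.ofReal C * ENNReal.ofReal (η / (2 * C)) := by gcongr
      _ = ENNReal.ofReal (η / 2) := by
          rw [← ENNReal.ofReal_mul hC.le]; congr 1; field_simp
  have h2 : eLpNorm (fun x => ∑ Q ∈ t, ε Q * halfTwistedDifference b 𝒯 Q φ x)
      (ENNReal.ofReal q) volume ≤ ENNReal.ofReal (η / 2) := by
    set h := fun x => ∑ Q ∈ t, ε Q * halfTwistedDifference b 𝒯 Q φ x with hh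
    have hsupp : Function.support h ⊆ S₀.toSet := by
      intro x hx
      by_contra hxS
      refine hx (Finset.sum_eq_zero fun Q _ => ?_)
      rw [halfTwistedDifference_eq_zero fun hxQ => hxS (Q.2.1 hxQ), mul_zero]
    have h3 := eLpNorm_le_eLpNorm_mul_rpow_measure_univ
      (μ := (volume : Measure (Fin n → ℝ)).restrict S₀.toSet)
      (ENNReal.ofReal_le_ofReal hq2) (hDm φ 2).1.restrict
    rw [eLpNorm_restrict_eq_of_support_subset hsupp, eLpNorm_restrict_eq_of_support_subset hsupp,
      Measure.restrict_apply_univ, ENNReal.toReal_ofReal hq0.le, ENNReal.toReal_ofReal two_pos.le,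
      ← ofReal_measureReal S₀.volume_toSet_lt_top.ne, ENNReal.ofReal_rpow_of_pos hv] at h3
    refine h3.trans ?_
    calc _ ≤ ENNReal.ofReal (η / (2 * c)) * ENNReal.ofReal c := by
          rw [hc]; gcongr; rw [← hc]; exact hs t ht
      _ = ENNReal.ofReal (η / 2) := by
          rw [← ENNReal.ofReal_mul (by positivity)]; congr 1; field_simp
  rw [hsub]
  refine (eLpNorm_add_le (hDm _ (ENNReal.ofReal q)).1 (hDm _ (ENNReal.ofReal q)).1
    (by simpa using hq.le)).trans ((add_le_add h1 h2).trans_eq ?_)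
  rw [← ENNReal.ofReal_add (by positivity) (by positivity), add_halves]

end Convergence

/-- The `L^q` inequality for transforms of half-twisted martingale differences. The series over
`𝒬` converges unconditionally in `L^q`, and its sum `g` obeys `‖g‖_q ≤ C ‖f‖_q`. -/
theorem theorem2p2 {𝕜 : Type*} [RCLike 𝕜] (n : ℕ) (hn : 1 ≤ n)
    (p q : ℝ) (hp : 1 < p) (hq : 1 < q) (A δ : ℝ) (hδ₀ : 0 < δ) (hδ₁ : δ < 1) :
    ∃ C : ℝ, 0 < C ∧
      ∀ (S₀ : DyadicCube n) (b : (Fin n → ℝ) → 𝕜),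
        Function.support b ⊆ S₀.toSet →
        MemLp b (ENNReal.ofReal p) volume →
        ∫ x, b x = ((volume.real S₀.toSet : ℝ) : 𝕜) →
        eLpNorm b (ENNReal.ofReal p) volume
          ≤ ENNReal.ofReal (A * volume.real S₀.toSet ^ (1 / p)) →
        ∀ 𝒯 : Set (DyadicCube n), IsTerminalFamily S₀ b p A δ 𝒯 →
        ∀ ε : DyadicCube n → 𝕜, (∀ Q ∈ nonterminalCubes S₀ 𝒯, ‖ε Q‖ ≤ 1) →
        ∀ f : (Fin n → ℝ) → 𝕜, MemLp f (ENNReal.ofReal q) volume →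
          ∃ g : (Fin n → ℝ) → 𝕜, MemLp g (ENNReal.ofReal q) volume ∧
            Tendsto (fun F : Finset (nonterminalCubes S₀ 𝒯) =>
                eLpNorm (fun x => (∑ Q ∈ F, ε Q * halfTwistedDifference b 𝒯 Q f x) - g x)
                  (ENNReal.ofReal q) volume) atTop (𝓝 0) ∧
            eLpNorm g (ENNReal.ofReal q) volume
              ≤ ENNReal.ofReal C * eLpNorm f (ENNReal.ofReal q) volume := by
  obtain ⟨C, hC, h⟩ := exists_eLpNorm_sum_halfTwistedDifference_le (𝕜 := 𝕜) hn hp hq A hδ₀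
  refine ⟨C, hC, fun S₀ b _ hb _ _ 𝒯 h𝒯 ε hε f hf => ?_⟩
  exact exists_tendsto_eLpNorm_sum_sub hq.le
    (fun Q : nonterminalCubes S₀ 𝒯 =>
      (memLp_halfTwistedDifference b 𝒯 Q f (ENNReal.ofReal q)).const_mul (ε Q))
    (fun F => h S₀ b hb 𝒯 h𝒯 F ε hε f hf)
    fun η hη => exists_tail_halfTwistedDifference_le hn hp hq hδ₀ hb h𝒯 hε hf hη
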